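/- Let $\Bbbk=\mathbb R$ or $\mathbb C$; all Lie algebras, linear maps and dimensions are over $\Bbbk$. Let $\mathfrak m=\mathfrak g_{-s}\oplus\dots\oplus\mathfrak g_{-1}$ be a finite-dimensional graded nilpotent Lie algebra that is fundamental, i.e. $\mathfrak m$ is generated by $\mathfrak g_{-1}$ and $\mathfrak z(\mathfrak m)\cap\mathfrak g_{-1}=0$. Let $\mathfrak g_0\subset\mathfrak{gl}(\mathfrak g_{-1})$ be an irreducible Lie subalgebra, and suppose that $\mathfrak m$ is $\mathfrak g_0$ sub-free, i.e. the action of $\mathfrak g_0$ on $\mathfrak g_{-1}$ extends to all components $\mathfrak g_{-k}$ by grading-preserving derivations of $\mathfrak m$ (so $\mathfrak g_0\subset\mathfrak{der}_0(\mathfrak m)$). The Tanaka prolongation $\mathrm{pr}(\mathfrak m,\mathfrak g_0)=\mathfrak m\oplus\mathfrak g_0\oplus\mathfrak g_1\oplus\mathfrak g_2\oplus\cdots$ is constructed successively: for $k\ge1$, $\mathfrak g_k$ is the space of linear maps $u:\mathfrak m\to\mathfrak m\oplus\mathfrak g_0\oplus\dots\oplus\mathfrak g_{k-1}$ with $u(\mathfrak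 g_p)\subset\mathfrak g_{p+k}$ for all $p<0$ and $u([x,y])=[u(x),y]+[x,u(y)]$ for all $x,y\in\mathfrak m$, where $[v,y]=-[y,v]=v(y)$ for $v\in\mathfrak g_j$, $j\ge0$, $y\in\mathfrak m$. Unless $\mathfrak m$ is a Heisenberg algebra, the pair $(\mathfrak m,\mathfrak g_0)$ is of finite type: $\dim\mathrm{pr}(\mathfrak m,\mathfrak g_0)<\infty$. Here a Heisenberg algebra is a Lie algebra whose centre is one-dimensional and coincides with its derived algebra; for $\Bbbk=\mathbb R$, the real Lie algebra underlying a complex Heisenberg algebra is also counted as a Heisenberg algebra. -/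

import Mathlib

universe u v

-- The commutator bracket on `Module.End`.
attribute [local instance 100] LieRing.ofAssociativeRing

/-- `𝒢` makes the finite-dimensional Lie algebra `L` a fundamental graded nilpotent Lie algebra
`L = 𝔤₋ₛ ⊕ ⋯ ⊕ 𝔤₋₁` with `𝔤ₖ = 𝒢 k`: only negative degrees occur (so `L` is nilpotent), `𝔤₋₁`
generates `L`, and `𝔤₋₁` contains no nonzero central element. -/
structure IsFundamentalGNLA (𝕜 : Type u) [Field 𝕜] {L : Type v} [LieRing L] [LieAlgebra 𝕜 L]
    (𝒢 : ℤ → Submodule 𝕜 L) : Prop where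
  finiteDimensional : FiniteDimensional 𝕜 L
  isInternal : DirectSum.IsInternal 𝒢
  lie_mem : ∀ (i j : ℤ) (x y : L), x ∈ 𝒢 i → y ∈ 𝒢 j → ⁅x, y⁆ ∈ 𝒢 (i + j)
  eq_bot_of_nonneg : ∀ k : ℤ, 0 ≤ k → 𝒢 k = ⊥
  generates : LieSubalgebra.lieSpan 𝕜 L (𝒢 (-1) : Set L) = ⊤
  central_eq_zero : ∀ x ∈ 𝒢 (-1), (∀ y : L, ⁅x, y⁆ = 0) → x = 0

/-- The action of `𝔤₀ ⊆ 𝔤𝔩(𝔤₋₁)` extends to all components `𝔤₋ₖ`: every `A ∈ 𝔤₀` is the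
restriction to `𝔤₋₁` of a grading-preserving derivation of `L`. (As `𝔤₋₁` generates `L`, that
derivation is unique, so that this makes each `𝔤₋ₖ` a representation of `𝔤₀`, compatibly with
the brackets.) -/
def ActsByDerivations (𝕜 : Type u) [Field 𝕜] {L : Type v} [LieRing L] [LieAlgebra 𝕜 L]
    (𝒢 : ℤ → Submodule 𝕜 L) (g₀ : LieSubalgebra 𝕜 (Module.End 𝕜 (𝒢 (-1)))) : Prop :=
  ∀ A ∈ g₀, ∃ D : LieDerivation 𝕜 L L,
    (∀ (k : ℤ) (x : L), x ∈ 𝒢 k → D x ∈ 𝒢 k) ∧ ∀ x : 𝒢 (-1), D (x : L) = (A x : L)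

/-- A `𝔤₀` sub-free Lie algebra: a fundamental graded nilpotent Lie algebra together with an
irreducible Lie subalgebra `𝔤₀ ⊆ 𝔤𝔩(𝔤₋₁)` represented on all its components. -/
structure IsSubFree (𝕜 : Type u) [Field 𝕜] {L : Type v} [LieRing L] [LieAlgebra 𝕜 L]
    (𝒢 : ℤ → Submodule 𝕜 L) (g₀ : LieSubalgebra 𝕜 (Module.End 𝕜 (𝒢 (-1)))) : Prop where
  fundamental : IsFundamentalGNLA 𝕜 𝒢
  irreducible : LieModule.IsIrreducible 𝕜 g₀ (𝒢 (-1))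
  acts : ActsByDerivations 𝕜 𝒢 g₀

namespace Tanaka

/-- A graded vector space with a bilinear operation `act e y = [e, y]` for `y ∈ L`; it is used for
the partial sums `L ⊕ 𝔤₀ ⊕ ⋯ ⊕ 𝔤ₖ` of the prolongation. -/
structure Stage (𝕜 : Type u) [Field 𝕜] (L : Type v) [LieRing L] [LieAlgebra 𝕜 L] where
  carrier : Type v
  [addCommGroup : AddCommGroup carrier]
  [module : Module 𝕜 carrier]
  deg : ℤ → Submodule 𝕜 carrier
  act : carrier →ₗ[𝕜] L →ₗ[𝕜] carrier

attribute [instance] Stage.addCommGroup Stage.module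

/-- The initial stage: `L` itself, with its own grading and bracket. -/
def negPart (𝕜 : Type u) [Field 𝕜] {L : Type v} [LieRing L] [LieAlgebra 𝕜 L]
    (𝒢 : ℤ → Submodule 𝕜 L) : Stage 𝕜 L where
  carrier := L
  deg := 𝒢
  act := (LieAlgebra.ad 𝕜 L : L →ₗ[𝕜] Module.End 𝕜 L)

/-- The space of all linear maps `w : L → S` of degree `k` with
`w [x, y] = [w x, y] + [x, w y]`, where `[x, e] = -[e, x]` for `e ∈ S`. -/
def Stage.prolong {𝕜 : Type u} [Field 𝕜] {L : Type v} [LieRing L] [LieAlgebra 𝕜 L]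
    (𝒢 : ℤ → Submodule 𝕜 L) (S : Stage 𝕜 L) (k : ℤ) : Submodule 𝕜 (L →ₗ[𝕜] S.carrier) where
  carrier := {w | (∀ (p : ℤ) (x : L), x ∈ 𝒢 p → w x ∈ S.deg (p + k)) ∧
    ∀ x y : L, w ⁅x, y⁆ = S.act (w x) y - S.act (w y) x}
  add_mem' := by
    rintro a b ⟨ha, ha'⟩ ⟨hb, hb'⟩
    refine ⟨fun p x hx => add_mem (ha p x hx) (hb p x hx), fun x y => ?_⟩
    simp only [LinearMap.add_apply, map_add, ha', hb']
    abel
  zero_mem' := ⟨fun p x _ => zero_mem _, fun x y => by simp⟩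
  smul_mem' := by
    rintro c a ⟨ha, ha'⟩
    refine ⟨fun p x hx => Submodule.smul_mem _ c (ha p x hx), fun x y => ?_⟩
    simp only [LinearMap.smul_apply, map_smul, ha', smul_sub]

/-- The stage `S ⊕ P`, where the new summand `P ⊆ Hom(L, S)` has degree `k` and `[w, y] = w y` for
`w ∈ P` and `y ∈ L`. -/
def Stage.extend {𝕜 : Type u} [Field 𝕜] {L : Type v} [LieRing L] [LieAlgebra 𝕜 L]
    (S : Stage 𝕜 L) (k : ℤ) (P : Submodule 𝕜 (L →ₗ[𝕜] S.carrier)) : Stage 𝕜 L where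
  carrier := S.carrier × P
  deg i := (S.deg i).prod (if i = k then ⊤ else ⊥)
  act := LinearMap.mk₂ 𝕜 (fun e y => (S.act e.1 y + (e.2 : L →ₗ[𝕜] S.carrier) y, 0))
    (fun a b y => by ext <;> simp; abel)
    (fun c a y => by ext <;> simp)
    (fun a y z => by ext <;> simp; abel)
    (fun c a y => by ext <;> simp)

/-- The degree-zero part of the prolongation: the grading-preserving derivations of `L` whose
restriction to `𝔤₋₁` belongs to `𝔤₀`. -/
def zeroPart {𝕜 : Type u} [Field 𝕜] {L : Type v} [LieRing L] [LieAlgebra 𝕜 L]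
    (𝒢 : ℤ → Submodule 𝕜 L) (g₀ : LieSubalgebra 𝕜 (Module.End 𝕜 (𝒢 (-1)))) :
    Submodule 𝕜 (L →ₗ[𝕜] (negPart 𝕜 𝒢).carrier) where
  carrier := {w | w ∈ (negPart 𝕜 𝒢).prolong 𝒢 0 ∧
    ∃ A ∈ g₀, ∀ x : 𝒢 (-1), w (x : L) = (A x : L)}
  add_mem' := by
    rintro a b ⟨ha, A, hA, hA'⟩ ⟨hb, B, hB, hB'⟩
    exact ⟨add_mem ha hb, A + B, add_mem hA hB, fun x => by
      rw [LinearMap.add_apply, hA', hB']; rfl⟩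
  zero_mem' := ⟨zero_mem _, 0, zero_mem _, fun x => rfl⟩
  smul_mem' := by
    rintro c a ⟨ha, A, hA, hA'⟩
    exact ⟨Submodule.smul_mem _ c ha, c • A, g₀.smul_mem c hA, fun x => by
      rw [LinearMap.smul_apply, hA']; rfl⟩

/-- `stage 𝒢 g₀ k = L ⊕ 𝔤₀ ⊕ 𝔤₁ ⊕ ⋯ ⊕ 𝔤ₖ`. -/
def stage {𝕜 : Type u} [Field 𝕜] {L : Type v} [LieRing L] [LieAlgebra 𝕜 L]
    (𝒢 : ℤ → Submodule 𝕜 L) (g₀ : LieSubalgebra 𝕜 (Module.End 𝕜 (𝒢 (-1)))) : ℕ → Stage 𝕜 L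
  | 0 => (negPart 𝕜 𝒢).extend 0 (zeroPart 𝒢 g₀)
  | k + 1 => (stage 𝒢 g₀ k).extend (k + 1) ((stage 𝒢 g₀ k).prolong 𝒢 (k + 1))

/-- The component `𝔤ₖ₊₁` of the prolongation: the maps `L → L ⊕ 𝔤₀ ⊕ ⋯ ⊕ 𝔤ₖ` of degree `k + 1`
that satisfy the Jacobi identity. -/
abbrev posPart {𝕜 : Type u} [Field 𝕜] {L : Type v} [LieRing L] [LieAlgebra 𝕜 L]
    (𝒢 : ℤ → Submodule 𝕜 L) (g₀ : LieSubalgebra 𝕜 (Module.End 𝕜 (𝒢 (-1)))) (k : ℕ) :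
    Submodule 𝕜 (L →ₗ[𝕜] (stage 𝒢 g₀ k).carrier) :=
  (stage 𝒢 g₀ k).prolong 𝒢 (k + 1)

/-- The (underlying vector space of the) Tanaka prolongation
`pr(L, 𝔤₀) = L ⊕ 𝔤₀ ⊕ 𝔤₁ ⊕ 𝔤₂ ⊕ ⋯`. -/
abbrev Prolongation {𝕜 : Type u} [Field 𝕜] {L : Type v} [LieRing L] [LieAlgebra 𝕜 L]
    (𝒢 : ℤ → Submodule 𝕜 L) (g₀ : LieSubalgebra 𝕜 (Module.End 𝕜 (𝒢 (-1)))) : Type v :=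
  L × zeroPart 𝒢 g₀ × DirectSum ℕ (fun k => posPart 𝒢 g₀ k)

end Tanaka

/-- A Heisenberg Lie algebra over the field `K`: its centre is one-dimensional and is equal to the
derived algebra. Equivalently, it is `V ⊕ K z` with `[v, w] = ω(v, w) z` for a symplectic vector
space `(V, ω)`, `V ≠ 0`. -/
def IsHeisenbergOver (K : Type u) [Field K] (L : Type v) [LieRing L] [LieAlgebra K L] : Prop :=
  ⁅(⊤ : LieIdeal K L), (⊤ : LieIdeal K L)⁆ = LieAlgebra.center K L ∧
    Module.finrank K (LieAlgebra.center K L) = 1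

/-- `L` is a Heisenberg algebra over `𝕜` (which is `ℝ` or `ℂ`), or the real Lie algebra underlying
a complex Heisenberg algebra. For `𝕜 = ℂ` the second alternative adds nothing: the centre, which is
the derived algebra, has real dimension two and so complex dimension one. -/
def IsHeisenberg (𝕜 : Type u) [RCLike 𝕜] (L : Type v) [LieRing L] [LieAlgebra 𝕜 L] : Prop :=
  IsHeisenbergOver 𝕜 L ∨
    ∃ _ : LieAlgebra ℂ L, (∀ (r : ℝ) (x : L), (r : ℂ) • x = (r : 𝕜) • x) ∧ IsHeisenbergOver ℂ L

/-!
The prolongation `U = L ⊕ 𝔤₀ ⊕ 𝔤₁ ⊕ ⋯` is a graded `L`-module with finite-dimensional components, in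
which an element of degree `≥ 0` is determined by its brackets with `L`. So in large degrees only
zero is annihilated by `L`. The prolongation is finite-dimensional if this remains true with `L`
replaced by each term `Cʲ L` of its lower central series, because some `Cʲ L` is zero.

*Passing from `Cʲ L` to `Cʲ⁺¹ L`.* Let `M` be the graded dual of `U`. On `X = M / [Cʲ⁺¹ L, M]` the
operators from `Cʲ L` commute with all of `L`, and they generate a commutative algebra `R`, over
which `X` is finitely generated by a graded Nakayama argument. If all maximal ideals of `R` contain
these generators, then these are nilpotent and `X` is finite-dimensional, which gives the claim for
`Cʲ⁺¹ L`. Otherwise some maximal ideal `m` yields a finite extension `K = R / m` of the base field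
and a nonzero finite-dimensional `K`-space `X / m X` on which `Cʲ L` acts by scalars, not all of
them zero (`IsGradedModule.exists_character`). For `j ≥ 1` this is impossible, as commutators have
trace zero.

*Vectors of rank one.* Only the step from `L` to `[L, L]` can fail. Then the action of `L` on
`X / m X` is given by a nonzero `l : L → K` vanishing on `[L, L]`, and a functional on `X / m X`
is a formal sum of elements `Xₙ(c) ∈ Uₙ`, `c ∈ K`, with `[y, Xₙ(c)] = -Xₙ₋₁(c l(y))`. Its component
of degree `0` consists of derivations `y ↦ φ(c l(y))` of `L`, with `φ = X₋₁ : K → 𝔤₋₁` nonzero. The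
derivation property gives `[φ(c), y] = γ(c l(y))` for some `γ : K → L`: the vectors `φ(c)` have rank
one over `K` (`IsFundamentalGNLA.finiteDimensional_or_exists_isRankOne`).

*Heisenberg algebras.* If the range of `γ` is a line, then `K` may be replaced by the base field;
otherwise `K ≅ ℂ` and `γ` is injective. The span of all vectors of rank one with `γ` injective is
invariant under automorphisms, hence, by exponentiating, under `𝔤₀`, and so it is `𝔤₋₁`. In
particular two families of rank one do not commute. Applying a derivation `D` to their bracket
shows that `D ∘ γ - γ ∘ m`, for a suitable `m ∈ K`, comes from a derivation of the field `K` and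
is therefore zero (`IsRankOne.exists_derivation_eq`). Thus the vectors of rank one with this
particular `γ` form a `𝔤₀`-invariant subspace, which is again all of `𝔤₋₁`
(`IsSubFree.exists_isRankOne`). Then `L = 𝔤₋₁ ⊕ γ(K)`, with `γ(K)` both the centre and the derived
algebra, and `K` acts on `L` with `K`-bilinear bracket: `L` is a Heisenberg algebra over `K`
(`IsSubFree.isHeisenberg`).
-/

universe w

section

open LieModule

/-! ### Finitely generated modules over commutative algebras -/

/-- A finitely generated module over a commutative algebra with finite generating set `s` is
finite-dimensional, provided that every maximal ideal contains `s`. -/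
theorem finiteDimensional_of_forall_isMaximal {𝕜 R X : Type*} [Field 𝕜] [CommRing R] [Algebra 𝕜 R]
    [AddCommGroup X] [Module 𝕜 X] [Module R X] [IsScalarTower 𝕜 R X] [Module.Finite R X]
    {s : Set R} (hs : s.Finite) (hgen : Algebra.adjoin 𝕜 s = ⊤)
    (h : ∀ m : Ideal R, m.IsMaximal → s ⊆ m) : FiniteDimensional 𝕜 X := by
  have hft : Algebra.FiniteType 𝕜 R := ⟨⟨hs.toFinset, by simpa using hgen⟩⟩
  have hJ : IsJacobsonRing R := isJacobsonRing_of_finiteType (A := 𝕜)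
  -- Over a Jacobson ring an element of all maximal ideals is nilpotent, so that `R` is
  -- integral over `𝕜`.
  have hnil : ∀ x ∈ s, IsNilpotent x := fun x hx => by
    have h1 : x ∈ (nilradical R).jacobson :=
      Ideal.mem_jacobson_iff.mpr fun y => by
        have : x ∈ Ideal.jacobson (⊥ : Ideal R) := by
          rw [Ideal.jacobson, Ideal.mem_sInf]
          exact fun {J} hJ => h J hJ.2 hx
        obtain ⟨z, hz⟩ := Ideal.mem_jacobson_iff.mp this y
        exact ⟨z, by rw [Ideal.mem_bot.mp hz]; exact zero_mem _⟩
    rw [isJacobsonRing_iff.mp hJ (nilradical R) (Ideal.radical_isRadical ⊥)] at h1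
    exact mem_nilradical.mp h1
  have hfin : Module.Finite 𝕜 R := by
    have := fg_adjoin_of_finite (R := 𝕜) hs fun x hx => by
      obtain ⟨n, hn⟩ := hnil x hx
      exact ⟨Polynomial.X ^ n, Polynomial.monic_X_pow n, by simp [hn]⟩
    rw [hgen] at this
    exact ⟨this⟩
  exact Module.Finite.trans R X

/-- Nakayama's lemma for a faithful module. -/
theorem smul_top_ne_top_of_faithful {R X : Type*} [CommRing R] [AddCommGroup X] [Module R X]
    [Module.Finite R X] (hfaith : ∀ r : R, (∀ x : X, r • x = 0) → r = 0)
    (m : Ideal R) (hm : m ≠ ⊤) : (m • ⊤ : Submodule R X) ≠ ⊤ := by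
  intro htop
  obtain ⟨r, hr, hr'⟩ := Submodule.exists_sub_one_mem_and_smul_eq_zero_of_fg_of_le_smul m
    (⊤ : Submodule R X) Module.Finite.fg_top htop.ge
  have : r = 0 := hfaith r fun x => hr' x trivial
  rw [this, zero_sub, neg_mem_iff] at hr
  exact hm ((Ideal.eq_top_iff_one m).mpr hr)

/-- The dichotomy for a Lie module `X` over `L` that is finitely generated and faithful over a
commutative algebra `R` commuting with `L`: either `X` is finite-dimensional, or it has a nonzero
quotient `X / m X`, for a maximal ideal `m` that misses some of the generators `r w` of `R`. -/
theorem finiteDimensional_or_exists_residue_of_smul {𝕜 L : Type*} {X : Type u} {R : Type v}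
    [Field 𝕜] [LieRing L] [LieAlgebra 𝕜 L] [AddCommGroup X] [Module 𝕜 X] [LieRingModule L X]
    [LieModule 𝕜 L X] [CommRing R] [Algebra 𝕜 R] [Module R X] [IsScalarTower 𝕜 R X] [Module.Finite R X]
    (I : Submodule 𝕜 L) [FiniteDimensional 𝕜 I] (r : I →ₗ[𝕜] R)
    (hr : ∀ (w : I) (x : X), r w • x = ⁅(w : L), x⁆)
    (hgen : Algebra.adjoin 𝕜 (Set.range r) = ⊤)
    (hfaith : ∀ a : R, (∀ x : X, a • x = 0) → a = 0)
    (hcomm : ∀ (y : L) (a : R) (x : X), ⁅y, a • x⁆ = a • ⁅y, x⁆) :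
    FiniteDimensional 𝕜 X ∨ ∃ (K : Type v) (_ : Field K) (_ : Algebra 𝕜 K)
      (_ : FiniteDimensional 𝕜 K) (Q : Type u) (_ : AddCommGroup Q) (_ : Module 𝕜 Q)
      (_ : Module K Q) (_ : IsScalarTower 𝕜 K Q) (_ : Module.Finite K Q) (_ : Nontrivial Q)
      (π : X →ₗ[𝕜] Q) (ρ : L → Module.End K Q) (l : I →ₗ[𝕜] K),
      Function.Surjective π ∧ (∀ y x, π ⁅y, x⁆ = ρ y (π x)) ∧
        (∀ (w : I) q, ρ w q = l w • q) ∧ l ≠ 0 := by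
  let b := Module.finBasis 𝕜 I
  let S : Set R := Set.range fun i => r (b i)
  have hSgen : Algebra.adjoin 𝕜 S = ⊤ := by
    rw [eq_top_iff, ← hgen]
    refine Algebra.adjoin_le ?_
    rintro _ ⟨w, rfl⟩
    rw [← b.sum_repr w, map_sum]
    refine sum_mem fun i _ => ?_
    rw [map_smul]
    refine Subalgebra.smul_mem _ (Algebra.subset_adjoin ?_) _
    exact ⟨i, rfl⟩
  by_cases hmax : ∀ m : Ideal R, m.IsMaximal → S ⊆ m
  · exact Or.inl
      (finiteDimensional_of_forall_isMaximal (R := R) (s := S) (Set.finite_range _) hSgen hmax)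
  right
  push Not at hmax
  obtain ⟨m, hm, hSm⟩ := hmax
  have hQ := smul_top_ne_top_of_faithful hfaith m hm.ne_top
  let _ : Field (R ⧸ m) := Ideal.Quotient.field m
  have hft : Algebra.FiniteType 𝕜 R :=
    ⟨⟨(Set.finite_range fun i => r (b i)).toFinset, by rw [Set.Finite.coe_toFinset]; exact hSgen⟩⟩
  have : Algebra.FiniteType 𝕜 (R ⧸ m) :=
    hft.of_surjective (Ideal.Quotient.mkₐ 𝕜 m) (Ideal.Quotient.mkₐ_surjective 𝕜 m)
  have hKfin : FiniteDimensional 𝕜 (R ⧸ m) := finite_of_finite_type_of_isJacobsonRing 𝕜 (R ⧸ m)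
  let Q := X ⧸ (m • ⊤ : Submodule R X)
  have hQ' : Nontrivial Q := Submodule.Quotient.nontrivial_iff.mpr hQ
  have hfinQ : Module.Finite (R ⧸ m) Q := Module.Finite.of_restrictScalars_finite R (R ⧸ m) Q
  have hst : IsScalarTower 𝕜 (R ⧸ m) Q := IsScalarTower.of_algebraMap_smul fun c q => by
    obtain ⟨x, rfl⟩ := Submodule.mkQ_surjective _ q
    change Submodule.mkQ _ (algebraMap 𝕜 R c • x) = Submodule.mkQ _ (c • x)
    rw [algebraMap_smul]
  obtain ⟨π, hπ⟩ : ∃ π : X →ₗ[𝕜] Q, ∀ x, π x = Submodule.Quotient.mk x :=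
    ⟨(Submodule.mkQ (m • ⊤ : Submodule R X)).restrictScalars 𝕜, fun x => rfl⟩
  have hπs : Function.Surjective π := fun q => by
    obtain ⟨x, hx⟩ := Submodule.mkQ_surjective _ q
    exact ⟨x, (hπ x).trans hx⟩
  obtain ⟨l, hl⟩ : ∃ l : I →ₗ[𝕜] R ⧸ m, ∀ w, l w = Ideal.Quotient.mk m (r w) :=
    ⟨(Ideal.Quotient.mkₐ 𝕜 m).toLinearMap ∘ₗ r, fun w => rfl⟩
  have hlπ : ∀ (w : I) (x : X), l w • π x = π ⁅(w : L), x⁆ := fun w x => by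
    rw [hπ, hl, hπ, ← hr]
    rfl
  have hρ : ∀ y : L, ∃ ρ : Module.End (R ⧸ m) Q, ∀ x, π ⁅y, x⁆ = ρ (π x) := fun y => by
    let T : X →ₗ[R] X :=
      { toFun := fun x => ⁅y, x⁆
        map_add' := fun x x' => lie_add y x x'
        map_smul' := fun a x => hcomm y a x }
    have hT : (m • ⊤ : Submodule R X) ≤ (m • ⊤ : Submodule R X).comap T := by
      rw [← Submodule.map_le_iff_le_comap, Submodule.map_smul'']
      exact Submodule.smul_mono le_rfl le_top
    refine ⟨LinearMap.extendScalarsOfSurjective Ideal.Quotient.mk_surjective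
      (Submodule.mapQ _ _ T hT), fun x => ?_⟩
    rw [hπ, hπ]
    rfl
  choose ρ hρ using hρ
  have hρl : ∀ (w : I) (q : Q), ρ w q = l w • q := fun w q => by
    obtain ⟨x, rfl⟩ := hπs q
    rw [← hρ, hlπ]
  have hl0 : l ≠ 0 := fun h0 => hSm <| by
    rintro _ ⟨i, rfl⟩
    refine Ideal.Quotient.eq_zero_iff_mem.mp ?_
    rw [← hl, h0, LinearMap.zero_apply]
  exact ⟨R ⧸ m, inferInstance, inferInstance, hKfin, Q, inferInstance, inferInstance,
    inferInstance, hst, hfinQ, hQ', π, ρ, l, hπs, fun y x => hρ y x, hρl, hl0⟩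

/-- A Lie module `X` over `L` on which a subspace `I` of `L` acts by operators commuting with the
action of `L`, and which is finitely generated over `I`, is either finite-dimensional or has a
nonzero quotient that is a finite-dimensional vector space over a finite extension `K` of `𝕜`,
with `L` acting `K`-linearly and `I` acting through a nonzero linear map `I → K`. -/
theorem finiteDimensional_or_exists_residue {𝕜 L : Type*} {X : Type u} [Field 𝕜] [LieRing L]
    [LieAlgebra 𝕜 L]
    [AddCommGroup X] [Module 𝕜 X] [LieRingModule L X] [LieModule 𝕜 L X]
    (I : Submodule 𝕜 L) [FiniteDimensional 𝕜 I]
    (hI : ∀ (y : L), ∀ w ∈ I, ∀ x : X, ⁅y, ⁅w, x⁆⁆ = ⁅w, ⁅y, x⁆⁆)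
    (X₀ : Submodule 𝕜 X) [FiniteDimensional 𝕜 X₀]
    (hgen : ∀ N : Submodule 𝕜 X, X₀ ≤ N → (∀ w ∈ I, ∀ x ∈ N, ⁅w, x⁆ ∈ N) → N = ⊤) :
    FiniteDimensional 𝕜 X ∨ ∃ (K : Type u) (_ : Field K) (_ : Algebra 𝕜 K)
      (_ : FiniteDimensional 𝕜 K) (Q : Type u) (_ : AddCommGroup Q) (_ : Module 𝕜 Q)
      (_ : Module K Q) (_ : IsScalarTower 𝕜 K Q) (_ : Module.Finite K Q) (_ : Nontrivial Q)
      (π : X →ₗ[𝕜] Q) (ρ : L → Module.End K Q) (l : I →ₗ[𝕜] K),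
      Function.Surjective π ∧ (∀ y x, π ⁅y, x⁆ = ρ y (π x)) ∧
        (∀ (w : I) q, ρ w q = l w • q) ∧ l ≠ 0 := by
  let T : L →ₗ⁅𝕜⁆ Module.End 𝕜 X := LieModule.toEnd 𝕜 L X
  let s : Set (Module.End 𝕜 X) := Set.range fun w : I => T (w : L)
  have hcomm : ∀ x ∈ s, ∀ y ∈ s, x * y = y * x := by
    rintro _ ⟨w, rfl⟩ _ ⟨w', rfl⟩
    ext x
    exact hI _ _ w'.2 x
  let R := Algebra.adjoin 𝕜 s
  let _ : CommRing R :=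
    { (inferInstance : Ring R) with
      mul_comm := (Algebra.isMulCommutative_adjoin 𝕜 hcomm).is_comm.comm }
  let r : I →ₗ[𝕜] R := LinearMap.codRestrict (Subalgebra.toSubmodule R)
    (T.toLinearMap ∘ₗ I.subtype) fun w => Algebra.subset_adjoin ⟨w, rfl⟩
  have hfg : Module.Finite R X := by
    obtain ⟨t, ht⟩ := (Submodule.fg_iff_finiteDimensional X₀).mpr inferInstance
    refine ⟨⟨t, ?_⟩⟩
    have := hgen ((Submodule.span R (t : Set X)).restrictScalars 𝕜)
      (by rw [← ht, Submodule.span_le]; exact Submodule.subset_span)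
      (fun w hw x hx => (Submodule.span R (t : Set X)).smul_mem (r ⟨w, hw⟩) hx)
    exact (Submodule.restrictScalars_eq_top_iff _ _ _).mp this
  have hLcomm : ∀ (y : L) (a : R) (x : X), ⁅y, a • x⁆ = a • ⁅y, x⁆ := by
    rintro y ⟨a, ha⟩ x
    change T y (a x) = a (T y x)
    induction ha using Algebra.adjoin_induction generalizing x with
    | mem a ha => obtain ⟨w, rfl⟩ := ha; exact hI _ _ w.2 x
    | algebraMap c => simp [Module.algebraMap_end_apply]
    | add a a' _ _ h h' => simp [h, h']
    | mul a a' _ _ h h' => simp [h, h']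
  have hgen' : Algebra.adjoin 𝕜 (Set.range r) = ⊤ := by
    have h1 : Set.range r = ((↑) : R → Module.End 𝕜 X) ⁻¹' s := by
      ext ⟨a, ha⟩
      simp only [Set.mem_range, Set.mem_preimage, Subtype.ext_iff, s]
      rfl
    rw [h1]
    exact Algebra.adjoin_adjoin_coe_preimage
  exact finiteDimensional_or_exists_residue_of_smul (R := R) I r (fun w x => rfl) hgen'
    (fun a ha => Subtype.ext (LinearMap.ext ha)) hLcomm

/-! ### The lower central series of a fundamental graded nilpotent Lie algebra -/

section LowerCentralSeries

variable {𝕜 L : Type*} [Field 𝕜] [LieRing L] [LieAlgebra 𝕜 L] {𝒢 : ℤ → Submodule 𝕜 L}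

/-- In a graded Lie algebra the lower central series is spanned by homogeneous elements. -/
theorem IsFundamentalGNLA.lowerCentralSeries_le_span (h : IsFundamentalGNLA 𝕜 𝒢) (j : ℕ) :
    (lowerCentralSeries 𝕜 L L j).toSubmodule ≤
      Submodule.span 𝕜 {y | y ∈ lowerCentralSeries 𝕜 L L j ∧ ∃ i < 0, y ∈ 𝒢 i} := by
  have htop : (⊤ : Submodule 𝕜 L) = Submodule.span 𝕜 {y | ∃ i < 0, y ∈ 𝒢 i} := by
    refine le_antisymm ?_ le_top
    rw [← h.isInternal.submodule_iSup_eq_top]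
    refine iSup_le fun i y hy => ?_
    rcases lt_or_ge i 0 with hi | hi
    · exact Submodule.subset_span ⟨i, hi, hy⟩
    · rw [h.eq_bot_of_nonneg i hi, Submodule.mem_bot] at hy
      exact hy ▸ zero_mem _
  induction j with
  | zero =>
    intro y _
    have hy : y ∈ (⊤ : Submodule 𝕜 L) := trivial
    rw [htop] at hy
    simpa using hy
  | succ j ih =>
    rw [lowerCentralSeries_succ, LieSubmodule.lieIdeal_oper_eq_linear_span', Submodule.span_le]
    rintro _ ⟨x, -, y, hy, rfl⟩
    have hx : x ∈ (⊤ : Submodule 𝕜 L) := trivial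
    rw [htop] at hx
    have hy' : y ∈ Submodule.span 𝕜 {y | y ∈ lowerCentralSeries 𝕜 L L j ∧ ∃ i < 0, y ∈ 𝒢 i} :=
      ih hy
    clear hy
    induction hx using Submodule.span_induction with
    | zero => simp
    | add a b _ _ ha hb => rw [add_lie]; exact add_mem ha hb
    | smul c a _ ha => rw [smul_lie]; exact Submodule.smul_mem _ c ha
    | mem x hx =>
      induction hy' using Submodule.span_induction with
      | zero => simp
      | add a b _ _ ha hb =>
        rw [lie_add]; exact add_mem ha hb
      | smul c a _ ha =>
        rw [lie_smul]; exact Submodule.smul_mem _ c ha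
      | mem y hy =>
        obtain ⟨i, hi, hxi⟩ := hx
        obtain ⟨hyj, k, hk, hyk⟩ := hy
        refine Submodule.subset_span ⟨?_, i + k, by omega, h.lie_mem i k x y hxi hyk⟩
        exact LieSubmodule.lie_mem_lie (LieSubmodule.mem_top x) hyj

theorem IsFundamentalGNLA.exists_forall_lt_eq_bot (h : IsFundamentalGNLA 𝕜 𝒢) :
    ∃ s : ℤ, ∀ i < s, 𝒢 i = ⊥ := by
  have := h.finiteDimensional
  have hfin := WellFoundedGT.finite_ne_bot_of_iSupIndep h.isInternal.submodule_iSupIndep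
  obtain ⟨s, hs⟩ := hfin.bddBelow
  exact ⟨s, fun i hi => by_contra fun hne => absurd (hs hne) (not_le.mpr hi)⟩

theorem IsFundamentalGNLA.lowerCentralSeries_le_iSup (h : IsFundamentalGNLA 𝕜 𝒢) (j : ℕ) :
    (lowerCentralSeries 𝕜 L L j).toSubmodule ≤ ⨆ i : {i : ℤ // i < -j}, 𝒢 i := by
  induction j with
  | zero =>
    refine le_top.trans ?_
    rw [← h.isInternal.submodule_iSup_eq_top]
    refine iSup_le fun i => ?_
    rcases lt_or_ge i 0 with hi | hi
    · exact le_iSup (fun i : {i : ℤ // i < -((0 : ℕ) : ℤ)} => 𝒢 i) ⟨i, by simpa using hi⟩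
    · rw [h.eq_bot_of_nonneg i hi]; exact bot_le
  | succ j ih =>
    rw [lowerCentralSeries_succ, LieSubmodule.lieIdeal_oper_eq_linear_span', Submodule.span_le]
    rintro _ ⟨x, -, y, hy, rfl⟩
    have hx : x ∈ ⨆ i, 𝒢 i := by rw [h.isInternal.submodule_iSup_eq_top]; trivial
    induction hx using Submodule.iSup_induction' with
    | zero => simp
    | add a b _ _ ha hb => rw [add_lie]; exact add_mem ha hb
    | mem i x hx =>
      rcases lt_or_ge i 0 with hi | hi
      · have hy' : y ∈ ⨆ i : {i : ℤ // i < -j}, 𝒢 i := ih hy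
        clear hy
        induction hy' using Submodule.iSup_induction' with
        | zero => simp
        | add a b _ _ ha hb => rw [lie_add]; exact add_mem ha hb
        | mem k y hy =>
          exact Submodule.mem_iSup_of_mem
            (⟨i + k, by have := k.2; push_cast; omega⟩ : {i : ℤ // i < -((j + 1 : ℕ) : ℤ)})
            (h.lie_mem i k x y hx hy)
      · rw [h.eq_bot_of_nonneg i hi, Submodule.mem_bot] at hx
        simp [hx]

theorem IsFundamentalGNLA.exists_lowerCentralSeries_eq_bot (h : IsFundamentalGNLA 𝕜 𝒢) :
    ∃ j, lowerCentralSeries 𝕜 L L j = ⊥ := by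
  obtain ⟨s, hs⟩ := h.exists_forall_lt_eq_bot
  refine ⟨s.natAbs, ?_⟩
  rw [← LieSubmodule.toSubmodule_eq_bot, eq_bot_iff]
  refine (h.lowerCentralSeries_le_iSup _).trans (iSup_le fun i => ?_)
  rw [hs i (by have := i.2; omega)]

/-- Induction along the generating subspace `𝔤₋₁`. -/
theorem IsFundamentalGNLA.induction (h : IsFundamentalGNLA 𝕜 𝒢) (S : Submodule 𝕜 L)
    (h1 : 𝒢 (-1) ≤ S) (hlie : ∀ x ∈ S, ∀ y ∈ S, ⁅x, y⁆ ∈ S) (x : L) : x ∈ S := by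
  have : LieSubalgebra.lieSpan 𝕜 L (𝒢 (-1) : Set L) ≤
      { S with lie_mem' := fun {x y} hx hy => hlie x hx y hy } :=
    LieSubalgebra.lieSpan_le.mpr h1
  rw [h.generates] at this
  exact this trivial

end LowerCentralSeries

/-! ### Graded modules and their graded duals -/

/-- The projection onto a summand of a direct sum decomposition. -/
theorem exists_projection_of_iSupIndep {ι 𝕜 U : Type*} [Ring 𝕜] [AddCommGroup U] [Module 𝕜 U]
    {deg : ι → Submodule 𝕜 U} (hind : iSupIndep deg) (htop : ⨆ n, deg n = ⊤) (n : ι) :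
    ∃ p : U →ₗ[𝕜] deg n, (∀ X : deg n, p X = X) ∧ ∀ m ≠ n, ∀ X ∈ deg m, p X = 0 := by
  have hc : IsCompl (deg n) (⨆ (m) (_ : m ≠ n), deg m) := by
    refine ⟨hind n, codisjoint_iff.mpr (eq_top_iff.mpr ?_)⟩
    rw [← htop]
    refine iSup_le fun m => ?_
    by_cases hm : m = n
    · exact hm ▸ le_sup_left
    · exact le_sup_of_le_right (le_iSup₂_of_le m hm le_rfl)
  refine ⟨Submodule.projectionOnto _ _ hc, Submodule.projectionOnto_apply_left hc,
    fun m hm X hX => Submodule.projectionOnto_apply_of_mem_right hc ?_⟩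
  exact (le_iSup₂_of_le m hm le_rfl : deg m ≤ ⨆ (m) (_ : m ≠ n), deg m) hX

/-- A graded module over a graded Lie algebra, with finite-dimensional homogeneous components
which vanish in very negative degrees. -/
structure IsGradedModule {𝕜 L U : Type*} [Field 𝕜] [LieRing L] [LieAlgebra 𝕜 L]
    [AddCommGroup U] [Module 𝕜 U] [LieRingModule L U]
    (𝒢 : ℤ → Submodule 𝕜 L) (deg : ℤ → Submodule 𝕜 U) : Prop where
  finiteDimensional : ∀ n, FiniteDimensional 𝕜 (deg n)
  bounded_below : ∃ s : ℤ, ∀ n < s, deg n = ⊥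
  iSupIndep : iSupIndep deg
  iSup_eq_top : ⨆ n, deg n = ⊤
  lie_mem : ∀ i j y X, y ∈ 𝒢 i → X ∈ deg j → ⁅y, X⁆ ∈ deg (i + j)

section GradedDual

variable {𝕜 L U : Type*} [Field 𝕜] [LieRing L] [LieAlgebra 𝕜 L]
    [AddCommGroup U] [Module 𝕜 U] {𝒢 : ℤ → Submodule 𝕜 L} {deg : ℤ → Submodule 𝕜 U}

/-- The functionals vanishing in all degrees larger than `n`. -/
def dualFiltration (deg : ℤ → Submodule 𝕜 U) (n : ℤ) : Submodule 𝕜 (Module.Dual 𝕜 U) where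
  carrier := {f | ∀ m > n, ∀ X ∈ deg m, f X = 0}
  add_mem' hf hg m hm X hX := by simp [hf m hm X hX, hg m hm X hX]
  zero_mem' _ _ _ _ := rfl
  smul_mem' c f hf m hm X hX := by simp [hf m hm X hX]

theorem dualFiltration_mono {m n : ℤ} (h : m ≤ n) : dualFiltration deg m ≤ dualFiltration deg n :=
  fun _ hf k hk => hf k (h.trans_lt hk)

variable [LieRingModule L U]

/-- Functionals on a homogeneous component extend by zero. -/
theorem IsGradedModule.exists_dual_extension (hU : IsGradedModule 𝒢 deg) (n : ℤ) :
    ∃ E : Module.Dual 𝕜 (deg n) →ₗ[𝕜] Module.Dual 𝕜 U, (∀ g (X : deg n), E g X = g X) ∧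
      ∀ g, ∀ m ≠ n, ∀ X ∈ deg m, E g X = 0 := by
  obtain ⟨p, hp, hp'⟩ := exists_projection_of_iSupIndep hU.iSupIndep hU.iSup_eq_top n
  exact ⟨p.dualMap, fun g X => by rw [LinearMap.dualMap_apply, hp],
    fun g m hm X hX => by rw [LinearMap.dualMap_apply, hp' m hm X hX, map_zero]⟩

theorem IsGradedModule.eq_zero_of_forall_dual (hU : IsGradedModule 𝒢 deg) {n : ℤ} {X : U}
    (hX : X ∈ deg n)
    (h : ∀ f : Module.Dual 𝕜 U, (∀ m ≠ n, ∀ Y ∈ deg m, f Y = 0) → f X = 0) : X = 0 := by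
  have : (⟨X, hX⟩ : deg n) = 0 := (Module.forall_dual_apply_eq_zero_iff 𝕜 _).mp fun g => by
    obtain ⟨E, hE, hE'⟩ := hU.exists_dual_extension n
    rw [← hE]
    exact h (E g) (hE' g)
  exact congrArg Subtype.val this

theorem IsGradedModule.finiteDimensional_of_eventually_eq_bot (hU : IsGradedModule 𝒢 deg)
    (h : ∃ n₀ : ℤ, ∀ n > n₀, deg n = ⊥) : FiniteDimensional 𝕜 U := by
  obtain ⟨s, hs⟩ := hU.bounded_below
  obtain ⟨n, hn⟩ := h
  have := hU.finiteDimensional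
  have hP : FiniteDimensional 𝕜 (⨆ m : Finset.Icc s n, deg m : Submodule 𝕜 U) :=
    Submodule.finiteDimensional_iSup _
  have htop : (⨆ m : Finset.Icc s n, deg m : Submodule 𝕜 U) = ⊤ := by
    rw [eq_top_iff, ← hU.iSup_eq_top]
    refine iSup_le fun m => ?_
    rcases lt_or_ge n m with hm | hm
    · rw [hn m hm]; exact bot_le
    rcases lt_or_ge m s with hm' | hm'
    · rw [hs m hm']; exact bot_le
    · exact le_iSup (fun m : Finset.Icc s n => deg m) ⟨m, Finset.mem_Icc.mpr ⟨hm', hm⟩⟩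
  rw [htop] at hP
  exact Module.Finite.equiv (Submodule.topEquiv : (⊤ : Submodule 𝕜 U) ≃ₗ[𝕜] U)

theorem IsGradedModule.finiteDimensional_dualFiltration (hU : IsGradedModule 𝒢 deg) (n : ℤ) :
    FiniteDimensional 𝕜 (dualFiltration deg n) := by
  obtain ⟨s, hs⟩ := hU.bounded_below
  let P : Submodule 𝕜 U := ⨆ m : Finset.Icc s n, deg m
  have := hU.finiteDimensional
  have : FiniteDimensional 𝕜 P := Submodule.finiteDimensional_iSup _
  let r : dualFiltration deg n →ₗ[𝕜] Module.Dual 𝕜 P :=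
    P.subtype.dualMap ∘ₗ (dualFiltration deg n).subtype
  refine FiniteDimensional.of_injective r ?_
  rw [injective_iff_map_eq_zero]
  rintro ⟨f, hf⟩ hr
  have hker : (⊤ : Submodule 𝕜 U) ≤ LinearMap.ker f := by
    rw [← hU.iSup_eq_top]
    refine iSup_le fun m X hX => ?_
    rcases lt_or_ge n m with hm | hm
    · exact hf m hm X hX
    rcases lt_or_ge m s with hm' | hm'
    · rw [hs m hm', Submodule.mem_bot] at hX
      simp [hX]
    · have hXP : X ∈ P := Submodule.mem_iSup_of_mem
        (⟨m, Finset.mem_Icc.mpr ⟨hm', hm⟩⟩ : Finset.Icc s n) hX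
      exact LinearMap.congr_fun hr ⟨X, hXP⟩
  exact Subtype.ext (LinearMap.ext fun X => hker trivial)

variable [LieModule 𝕜 L U]

theorem IsGradedModule.lie_mem_dualFiltration (hU : IsGradedModule 𝒢 deg) {i n : ℤ} {y : L}
    (hy : y ∈ 𝒢 i) {f : Module.Dual 𝕜 U} (hf : f ∈ dualFiltration deg (n + i)) :
    ⁅y, f⁆ ∈ dualFiltration deg n := by
  intro m hm X hX
  rw [Module.Dual.lie_apply, hf (i + m) (by omega) _ (hU.lie_mem i m y X hy hX), neg_zero]

/-- The graded dual: the functionals on `U` that vanish in all large degrees. -/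
def IsGradedModule.dual (hU : IsGradedModule 𝒢 deg) (h : IsFundamentalGNLA 𝕜 𝒢) :
    LieSubmodule 𝕜 L (Module.Dual 𝕜 U) where
  carrier := {f | ∃ n, f ∈ dualFiltration deg n}
  add_mem' := by
    rintro f g ⟨m, hf⟩ ⟨n, hg⟩
    exact ⟨max m n, add_mem (dualFiltration_mono (le_max_left _ _) hf)
      (dualFiltration_mono (le_max_right _ _) hg)⟩
  zero_mem' := ⟨0, zero_mem _⟩
  smul_mem' := fun c f ⟨n, hf⟩ => ⟨n, Submodule.smul_mem _ c hf⟩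
  lie_mem := by
    rintro y f ⟨n, hf⟩
    have hy : y ∈ ⨆ i, 𝒢 i := by rw [h.isInternal.submodule_iSup_eq_top]; trivial
    induction hy using Submodule.iSup_induction' with
    | zero => exact ⟨n, by simp⟩
    | add a b _ _ ha hb =>
      obtain ⟨p, hp⟩ := ha
      obtain ⟨q, hq⟩ := hb
      refine ⟨max p q, ?_⟩
      rw [add_lie]
      exact add_mem (dualFiltration_mono (le_max_left _ _) hp)
        (dualFiltration_mono (le_max_right _ _) hq)
    | mem i y hy =>
      refine ⟨n - i, hU.lie_mem_dualFiltration hy ?_⟩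
      simpa using hf

end GradedDual

/-! ### Finiteness of graded modules and characters -/

section Characters

variable {𝕜 : Type u} {L : Type v} {U : Type w} [Field 𝕜] [LieRing L] [LieAlgebra 𝕜 L]
    [AddCommGroup U] [Module 𝕜 U] [LieRingModule L U] [LieModule 𝕜 L U]
    {𝒢 : ℤ → Submodule 𝕜 L} {deg : ℤ → Submodule 𝕜 U}

/-- In all large degrees, only zero is annihilated by the `j`-th term of the lower central
series of `L` (counted from `0`, which is `L` itself). -/
def EventuallyFaithful (𝕜 : Type u) {L : Type v} {U : Type w} [Field 𝕜] [LieRing L]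
    [LieAlgebra 𝕜 L] [AddCommGroup U] [Module 𝕜 U] [LieRingModule L U]
    (deg : ℤ → Submodule 𝕜 U) (j : ℕ) : Prop :=
  ∃ n₀ : ℤ, ∀ n > n₀, ∀ X ∈ deg n, (∀ y ∈ lowerCentralSeries 𝕜 L L j, ⁅y, X⁆ = 0) → X = 0

/-- One degree of the graded Nakayama lemma for the graded dual: a functional of degree at most `n`
is, up to one of smaller degree, a combination of functionals `[y, g]` of the same degree. -/
theorem IsGradedModule.dualFiltration_le (hU : IsGradedModule 𝒢 deg) (h : IsFundamentalGNLA 𝕜 𝒢)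
    (j : ℕ) (n : ℤ)
    (hn : ∀ X ∈ deg n, (∀ y ∈ lowerCentralSeries 𝕜 L L j, ⁅y, X⁆ = 0) → X = 0) :
    dualFiltration deg n ≤ dualFiltration deg (n - 1) ⊔
      Submodule.span 𝕜 {f | ∃ y ∈ lowerCentralSeries 𝕜 L L j,
        ∃ g ∈ dualFiltration deg (n - 1), ⁅y, g⁆ = f} := by
  set Z : Submodule 𝕜 (Module.Dual 𝕜 U) := Submodule.span 𝕜 {f | ∃ y ∈ lowerCentralSeries 𝕜 L L j,
    ∃ i < 0, y ∈ 𝒢 i ∧ ∃ g ∈ dualFiltration deg (n + i), ⁅y, g⁆ = f} with hZ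
  have hZn : Z ≤ dualFiltration deg n := Submodule.span_le.mpr <| by
    rintro _ ⟨y, -, i, -, hy, g, hg, rfl⟩
    exact hU.lie_mem_dualFiltration hy hg
  have hZ' : Z ≤ Submodule.span 𝕜 {f | ∃ y ∈ lowerCentralSeries 𝕜 L L j,
      ∃ g ∈ dualFiltration deg (n - 1), ⁅y, g⁆ = f} := Submodule.span_mono <| by
    rintro _ ⟨y, hy, i, hi, -, g, hg, rfl⟩
    exact ⟨y, hy, g, dualFiltration_mono (by omega) hg, rfl⟩
  -- restriction of functionals to the component of degree `n`
  let res : Module.Dual 𝕜 U →ₗ[𝕜] Module.Dual 𝕜 (deg n) := (deg n).subtype.dualMap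
  have := hU.finiteDimensional n
  have hsurj : Z.map res = ⊤ := by
    rw [← Subspace.dualCoannihilator_dualAnnihilator_eq (W := Z.map res)]
    have h0 : (Z.map res).dualCoannihilator = ⊥ := by
      rw [eq_bot_iff]
      rintro ⟨X, hX⟩ hXZ
      rw [Submodule.mem_dualCoannihilator] at hXZ
      have hX0 : X = 0 := by
        refine hn X hX fun y hy => ?_
        have hker : (lowerCentralSeries 𝕜 L L j).toSubmodule ≤
            LinearMap.ker ((LieModule.toEnd 𝕜 L U : L →ₗ[𝕜] Module.End 𝕜 U).flip X) := by
          refine (h.lowerCentralSeries_le_span j).trans (Submodule.span_le.mpr ?_)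
          rintro y ⟨hy, i, hi, hyi⟩
          refine hU.eq_zero_of_forall_dual (hU.lie_mem i n y X hyi hX) fun f hf => ?_
          have := hXZ (res ⁅y, f⁆) (Submodule.mem_map_of_mem (Submodule.subset_span
            ⟨y, hy, i, hi, hyi, f, fun m hm Y hY => hf m (by omega) Y hY, rfl⟩))
          simpa [res] using this
        exact hker hy
      simpa using hX0
    rw [h0, Submodule.dualAnnihilator_bot]
  intro f hf
  have hf' : res f ∈ Z.map res := by rw [hsurj]; trivial
  obtain ⟨z, hz, hzf⟩ := hf'
  rw [← sub_add_cancel f z]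
  refine Submodule.add_mem_sup (fun m hm X hX => ?_) (hZ' hz)
  rcases eq_or_ne m n with rfl | hmn
  · have := LinearMap.congr_fun hzf ⟨X, hX⟩
    simp only [res, LinearMap.dualMap_apply, Submodule.subtype_apply] at this
    rw [LinearMap.sub_apply, this, sub_self]
  · rw [LinearMap.sub_apply, hf m (by omega) X hX, hZn hz m (by omega) X hX, sub_zero]

/-- If the quotient of the graded dual by the action of `Cʲ L` is finite-dimensional, then only
zero is annihilated by `Cʲ L` in large degrees. -/
theorem IsGradedModule.eventuallyFaithful_of_finiteDimensional (hU : IsGradedModule 𝒢 deg)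
    (h : IsFundamentalGNLA 𝕜 𝒢) (j : ℕ)
    [FiniteDimensional 𝕜
      (hU.dual h ⧸ (⁅lowerCentralSeries 𝕜 L L j, ⊤⁆ : LieSubmodule 𝕜 L (hU.dual h)))] :
    EventuallyFaithful 𝕜 (L := L) deg j := by
  set N : LieSubmodule 𝕜 L (hU.dual h) := ⁅lowerCentralSeries 𝕜 L L j, ⊤⁆ with hN
  obtain ⟨t, ht⟩ := Module.finite_def.mp ‹FiniteDimensional 𝕜 (hU.dual h ⧸ N)›
  -- finitely many functionals span the quotient, and their degrees are bounded
  have hb : ∃ n₀ : ℤ, ∀ q ∈ t, ∃ f : hU.dual h,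
      (f : Module.Dual 𝕜 U) ∈ dualFiltration deg n₀ ∧ LieSubmodule.Quotient.mk (N := N) f = q := by
    clear ht
    classical
    induction t using Finset.induction_on with
    | empty => exact ⟨0, by simp⟩
    | insert q t _ ih =>
      obtain ⟨n₁, hn₁⟩ := ih
      obtain ⟨f, rfl⟩ := LieSubmodule.Quotient.surjective_mk' N q
      obtain ⟨n₂, hn₂⟩ := f.2
      refine ⟨max n₁ n₂, fun q hq => ?_⟩
      rcases Finset.mem_insert.mp hq with rfl | hq
      · exact ⟨f, dualFiltration_mono (le_max_right _ _) hn₂, rfl⟩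
      · obtain ⟨g, hg, rfl⟩ := hn₁ q hq
        exact ⟨g, dualFiltration_mono (le_max_left _ _) hg, rfl⟩
  obtain ⟨n₀, hn₀⟩ := hb
  refine ⟨n₀, fun n hn X hX hkill => hU.eq_zero_of_forall_dual hX fun f hf => ?_⟩
  -- evaluation at `X` vanishes on `N` and on the functionals of degree at most `n₀`
  let ev : hU.dual h →ₗ[𝕜] 𝕜 :=
    (Module.Dual.eval 𝕜 U X) ∘ₗ (hU.dual h).toSubmodule.subtype
  have hev : N.toSubmodule ≤ LinearMap.ker ev := by
    rw [hN, LieSubmodule.lieIdeal_oper_eq_linear_span', Submodule.span_le]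
    rintro _ ⟨y, hy, g, -, rfl⟩
    change (⁅y, (g : Module.Dual 𝕜 U)⁆) X = 0
    rw [Module.Dual.lie_apply, hkill y hy, map_zero, neg_zero]
  let ev' : (hU.dual h ⧸ N) →ₗ[𝕜] 𝕜 := N.toSubmodule.liftQ ev hev
  have hev' : ev' = 0 := by
    refine LinearMap.ext_on ht fun q hq => ?_
    obtain ⟨g, hg, rfl⟩ := hn₀ q hq
    exact hg n hn X hX
  exact LinearMap.congr_fun hev' (LieSubmodule.Quotient.mk
    (⟨f, n, fun m hm Y hY => hf m (by omega) Y hY⟩ : hU.dual h))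

/-- If `Cʲ L` acts faithfully in large degrees but `Cʲ⁺¹ L` does not, then the graded dual of `U`
has a nonzero quotient `Q` that is a finite-dimensional vector space over a finite extension `K` of `𝕜`,
on which `L` acts `K`-linearly and `Cʲ L` by a nonzero linear map `l : Cʲ L → K`. -/
theorem IsGradedModule.exists_character (hU : IsGradedModule 𝒢 deg)
    (h : IsFundamentalGNLA 𝕜 𝒢) {j : ℕ} (hj : EventuallyFaithful 𝕜 (L := L) deg j)
    (hj' : ¬ EventuallyFaithful 𝕜 (L := L) deg (j + 1)) :
    ∃ (K : Type (max u w)) (_ : Field K) (_ : Algebra 𝕜 K)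
      (_ : FiniteDimensional 𝕜 K) (Q : Type (max u w)) (_ : AddCommGroup Q) (_ : Module 𝕜 Q)
      (_ : Module K Q) (_ : IsScalarTower 𝕜 K Q) (_ : Module.Finite K Q) (_ : Nontrivial Q)
      (π : hU.dual h →ₗ[𝕜] Q) (ρ : L → Module.End K Q)
      (l : (lowerCentralSeries 𝕜 L L j).toSubmodule →ₗ[𝕜] K),
      Function.Surjective π ∧ (∀ y f, π ⁅y, f⁆ = ρ y (π f)) ∧
        (∀ (w : (lowerCentralSeries 𝕜 L L j).toSubmodule) q, ρ w q = l w • q) ∧ l ≠ 0 := by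
  have := h.finiteDimensional
  set N : LieSubmodule 𝕜 L (hU.dual h) := ⁅lowerCentralSeries 𝕜 L L (j + 1), ⊤⁆ with hN
  have hNmk : ∀ y ∈ lowerCentralSeries 𝕜 L L (j + 1), ∀ x : hU.dual h ⧸ N, ⁅y, x⁆ = 0 := by
    intro y hy x
    obtain ⟨f, rfl⟩ := LieSubmodule.Quotient.surjective_mk' N x
    rw [← LieModuleHom.map_lie]
    exact (LieSubmodule.Quotient.mk_eq_zero' (N := N)).mpr
      (LieSubmodule.lie_mem_lie hy (LieSubmodule.mem_top f))
  obtain ⟨n₀, hn₀⟩ := hj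
  -- the images of the steps of the filtration in the quotient
  let inc : (n : ℤ) → dualFiltration deg n →ₗ[𝕜] hU.dual h := fun n =>
    { toFun := fun f => ⟨f, n, f.2⟩
      map_add' := fun _ _ => rfl
      map_smul' := fun _ _ => rfl }
  let D : ℤ → Submodule 𝕜 (hU.dual h ⧸ N) := fun n =>
    LinearMap.range ((LieSubmodule.Quotient.mk' N : hU.dual h →ₗ[𝕜] hU.dual h ⧸ N) ∘ₗ inc n)
  have := hU.finiteDimensional_dualFiltration n₀
  have hD : FiniteDimensional 𝕜 (D n₀) := inferInstanceAs (FiniteDimensional 𝕜 (LinearMap.range _))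
  have hcomm : ∀ (y : L), ∀ w ∈ (lowerCentralSeries 𝕜 L L j).toSubmodule,
      ∀ x : hU.dual h ⧸ N, ⁅y, ⁅w, x⁆⁆ = ⁅w, ⁅y, x⁆⁆ := by
    intro y w hw x
    rw [leibniz_lie, hNmk, zero_add]
    rw [lowerCentralSeries_succ]
    exact LieSubmodule.lie_mem_lie (LieSubmodule.mem_top y) hw
  have hgen : ∀ P : Submodule 𝕜 (hU.dual h ⧸ N), D n₀ ≤ P →
      (∀ w ∈ (lowerCentralSeries 𝕜 L L j).toSubmodule, ∀ x ∈ P, ⁅w, x⁆ ∈ P) → P = ⊤ := by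
    intro P hP hPs
    have key : ∀ n ≥ n₀, D n ≤ P := by
      intro n hn
      induction n, hn using Int.leInduction with
      | base => exact hP
      | succ n hn ih =>
        rintro _ ⟨⟨f, hf⟩, rfl⟩
        have hf' := hU.dualFiltration_le h j (n + 1) (hn₀ (n + 1) (by omega)) hf
        rw [add_sub_cancel_right] at hf'
        -- the functionals of the graded dual whose class lies in `P`
        let P' : Submodule 𝕜 (Module.Dual 𝕜 U) :=
          (P.comap (LieSubmodule.Quotient.mk' N : hU.dual h →ₗ[𝕜] hU.dual h ⧸ N)).map
            ((hU.dual h).incl : hU.dual h →ₗ[𝕜] Module.Dual 𝕜 U)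
        have h1 : dualFiltration deg n ≤ P' := fun g hg =>
          ⟨⟨g, n, hg⟩, ih ⟨⟨g, hg⟩, rfl⟩, rfl⟩
        have h2 : Submodule.span 𝕜 {f | ∃ y ∈ lowerCentralSeries 𝕜 L L j,
            ∃ g ∈ dualFiltration deg n, ⁅y, g⁆ = f} ≤ P' := Submodule.span_le.mpr <| by
          rintro _ ⟨y, hy, g, hg, rfl⟩
          exact ⟨⁅y, (⟨g, n, hg⟩ : hU.dual h)⁆, hPs y hy _ (ih ⟨⟨g, hg⟩, rfl⟩), rfl⟩
        obtain ⟨g, hg, hgf⟩ := sup_le h1 h2 hf'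
        have : g = inc (n + 1) ⟨f, hf⟩ := Subtype.ext hgf
        change LieSubmodule.Quotient.mk' N (inc (n + 1) ⟨f, hf⟩) ∈ P
        rw [← this]
        exact hg
    rw [eq_top_iff]
    rintro x -
    obtain ⟨⟨f, n, hf⟩, rfl⟩ := LieSubmodule.Quotient.surjective_mk' N x
    exact key (max n n₀) (le_max_right _ _)
      ⟨⟨f, dualFiltration_mono (le_max_left _ _) hf⟩, rfl⟩
  rcases finiteDimensional_or_exists_residue (X := hU.dual h ⧸ N)
    (lowerCentralSeries 𝕜 L L j).toSubmodule hcomm (D n₀) hgen with hX | hX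
  · exact absurd (hU.eventuallyFaithful_of_finiteDimensional h (j + 1)) hj'
  · obtain ⟨K, i1, i2, i3, Q, i4, i5, i6, i7, i8, i9, π, ρ, l, hπ, hρ, hl, hl0⟩ := hX
    exact ⟨K, i1, i2, i3, Q, i4, i5, i6, i7, i8, i9,
      π ∘ₗ (LieSubmodule.Quotient.mk' N : hU.dual h →ₗ[𝕜] hU.dual h ⧸ N), ρ, l,
      hπ.comp (LieSubmodule.Quotient.surjective_mk' N),
      fun y f => hρ y (LieSubmodule.Quotient.mk' N f), hl, hl0⟩

/-- Beyond the first step, faithfulness propagates: for `j ≥ 1` the elements of `Cʲ L` are sums of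
commutators, so they cannot act on a finite-dimensional space by nonzero scalars. -/
theorem IsGradedModule.eventuallyFaithful_succ [CharZero 𝕜] (hU : IsGradedModule 𝒢 deg)
    (h : IsFundamentalGNLA 𝕜 𝒢) {j : ℕ} (hj : EventuallyFaithful 𝕜 (L := L) deg (j + 1)) :
    EventuallyFaithful 𝕜 (L := L) deg (j + 2) := by
  by_contra hj'
  obtain ⟨K, _, _, _, Q, _, _, _, _, _, _, π, ρ, l, hπ, hρ, hl, hl0⟩ :=
    hU.exists_character h hj hj'
  have : CharZero K := charZero_of_injective_algebraMap (algebraMap 𝕜 K).injective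
  have hbr : ∀ x y, ρ ⁅x, y⁆ = ρ x * ρ y - ρ y * ρ x := fun x y => by
    ext q
    obtain ⟨f, rfl⟩ := hπ q
    rw [← hρ, lie_lie, map_sub, hρ, hρ, hρ, hρ]
    rfl
  apply hl0
  have key : (lowerCentralSeries 𝕜 L L (j + 1)).toSubmodule ≤
      (LinearMap.ker l).map (lowerCentralSeries 𝕜 L L (j + 1)).toSubmodule.subtype := by
    conv_lhs => rw [lowerCentralSeries_succ, LieSubmodule.lieIdeal_oper_eq_linear_span']
    rw [Submodule.span_le]
    rintro _ ⟨x, -, y, hy, rfl⟩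
    have hxy : ⁅x, y⁆ ∈ (lowerCentralSeries 𝕜 L L (j + 1)).toSubmodule := by
      rw [lowerCentralSeries_succ]
      exact LieSubmodule.lie_mem_lie (LieSubmodule.mem_top x) hy
    refine ⟨⟨⁅x, y⁆, hxy⟩, ?_, rfl⟩
    have h1 : ρ ⁅x, y⁆ = l ⟨⁅x, y⁆, hxy⟩ • LinearMap.id := LinearMap.ext fun q => hl ⟨_, hxy⟩ q
    have h2 : LinearMap.trace K Q (ρ ⁅x, y⁆) = 0 := by
      rw [hbr, map_sub, LinearMap.trace_mul_comm, sub_self]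
    rw [h1, map_smul, LinearMap.trace_id, smul_eq_mul, mul_eq_zero, Nat.cast_eq_zero] at h2
    exact h2.resolve_right Module.finrank_pos.ne'
  ext w
  obtain ⟨w', hw', hww'⟩ := key w.2
  have : w' = w := Subtype.ext hww'
  exact this ▸ hw'

end Characters

/-! ### Formal eigenvectors -/

section RankOne

variable {𝕜 : Type u} {L : Type v} {U : Type w} [Field 𝕜] [LieRing L] [LieAlgebra 𝕜 L]
    [AddCommGroup U] [Module 𝕜 U] [LieRingModule L U] [LieModule 𝕜 L U]
    {𝒢 : ℤ → Submodule 𝕜 L} {deg : ℤ → Submodule 𝕜 U}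

/-- If `L` itself acts faithfully in large degrees but its derived algebra does not, then there is a
formal joint eigenvector `∑ₙ X n c`, with components `X n c ∈ deg n` depending linearly on a
scalar `c` in a finite extension `K` of `𝕜`, whose eigenvalue is a character `-l : L → K`. -/
theorem IsGradedModule.exists_formal_eigenvector (hU : IsGradedModule 𝒢 deg)
    (h : IsFundamentalGNLA 𝕜 𝒢) (h0 : EventuallyFaithful 𝕜 (L := L) deg 0)
    (h1 : ¬ EventuallyFaithful 𝕜 (L := L) deg 1) :
    ∃ (K : Type (max u w)) (_ : Field K) (_ : Algebra 𝕜 K) (_ : FiniteDimensional 𝕜 K)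
      (X : ℤ → K →ₗ[𝕜] U) (l : L →ₗ[𝕜] K),
      (∀ n c, X n c ∈ deg n) ∧ (∃ n c, X n c ≠ 0) ∧ (∀ x y : L, l ⁅x, y⁆ = 0) ∧ l ≠ 0 ∧
        ∀ (y : L) n c, ⁅y, X n c⁆ = -X (n - 1) (c * l y) := by
  obtain ⟨K, _, _, hK, Q, _, _, _, _, _, hQ, π, ρ, l, hπ, hρ, hl, hl0⟩ :=
    hU.exists_character h h0 h1
  let l' : L →ₗ[𝕜] K := l ∘ₗ LinearMap.codRestrict _ LinearMap.id fun y =>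
    (by simp : y ∈ (lowerCentralSeries 𝕜 L L 0).toSubmodule)
  have hρl : ∀ (y : L) f, π ⁅y, f⁆ = l' y • π f := fun y f => by
    rw [hρ]
    exact hl ⟨y, by simp⟩ (π f)
  have hl' : ∀ x y : L, l' ⁅x, y⁆ = 0 := fun x y => by
    obtain ⟨q, hq⟩ := exists_ne (0 : Q)
    obtain ⟨f, rfl⟩ := hπ q
    have := hρl ⁅x, y⁆ f
    rw [lie_lie, map_sub, hρl, hρl, hρl, hρl, smul_smul, smul_smul, mul_comm, sub_self] at this
    exact (smul_eq_zero.mp this.symm).resolve_right hq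
  have hl'0 : l' ≠ 0 := fun h0 => hl0 <| LinearMap.ext fun w => LinearMap.congr_fun h0 (w : L)
  obtain ⟨q, hq⟩ := exists_ne (0 : Q)
  obtain ⟨F, hF⟩ : ∃ F : Module.Dual 𝕜 Q, F q ≠ 0 := by
    by_contra hcon
    push Not at hcon
    exact hq ((Module.forall_dual_apply_eq_zero_iff 𝕜 q).mp hcon)
  choose E hE hE' using hU.exists_dual_extension
  have hEd : ∀ n g, E n g ∈ dualFiltration deg n := fun n g m hm Y hY =>
    hE' n g m (by omega) Y hY
  -- `X n c` represents the functional `g ↦ F (c • π g)` on the dual of `deg n`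
  let B : (n : ℤ) → K →ₗ[𝕜] Module.Dual 𝕜 (Module.Dual 𝕜 (deg n)) := fun n =>
    LinearMap.mk₂ 𝕜 (fun c g => F (c • π ⟨E n g, n, hEd n g⟩))
      (fun c d g => by rw [add_smul, map_add])
      (fun a c g => by rw [smul_assoc, map_smul])
      (fun c g g' => by
        rw [← map_add, ← smul_add, ← map_add]
        congr 3
        exact Subtype.ext (map_add (E n) g g'))
      (fun a c g => by
        rw [← map_smul F, ← smul_comm, ← map_smul π]
        congr 3
        exact Subtype.ext (map_smul (E n) a g))
  have := hU.finiteDimensional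
  let X : (n : ℤ) → K →ₗ[𝕜] U := fun n =>
    (deg n).subtype ∘ₗ (Module.evalEquiv 𝕜 (deg n)).symm.toLinearMap ∘ₗ B n
  have hXdeg : ∀ n c, X n c ∈ deg n := fun n c => Subtype.property _
  -- the defining property of `X`
  have hX : ∀ n c (f : hU.dual h), (∀ m ≠ n, ∀ Y ∈ deg m, (f : Module.Dual 𝕜 U) Y = 0) →
      (f : Module.Dual 𝕜 U) (X n c) = F (c • π f) := fun n c f hf => by
    let g : Module.Dual 𝕜 (deg n) := (f : Module.Dual 𝕜 U) ∘ₗ (deg n).subtype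
    have hgf : E n g = f := by
      have : (⊤ : Submodule 𝕜 U) ≤ LinearMap.ker (E n g - (f : Module.Dual 𝕜 U)) := by
        rw [← hU.iSup_eq_top]
        refine iSup_le fun m Y hY => ?_
        rw [LinearMap.mem_ker, LinearMap.sub_apply, sub_eq_zero]
        rcases eq_or_ne m n with rfl | hm
        · exact hE m g ⟨Y, hY⟩
        · rw [hE' n g m hm Y hY, hf m hm Y hY]
      exact LinearMap.ext fun Y => sub_eq_zero.mp (this (trivial : Y ∈ ⊤))
    have h2 : g ((Module.evalEquiv 𝕜 (deg n)).symm (B n c)) = B n c g := by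
      simp
    have h3 : (⟨E n g, n, hEd n g⟩ : hU.dual h) = f := Subtype.ext hgf
    calc (f : Module.Dual 𝕜 U) (X n c) = B n c g := h2
      _ = F (c • π f) := by rw [← h3]; rfl
  have hrec : ∀ y : L, ∀ n c, ⁅y, X n c⁆ = -X (n - 1) (c * l' y) := by
    let S : Submodule 𝕜 L :=
      { carrier := {y | ∀ n c, ⁅y, X n c⁆ = -X (n - 1) (c * l' y)}
        add_mem' := fun {a b} ha hb n c => by
          rw [add_lie, ha, hb, map_add, mul_add, map_add, neg_add]
        zero_mem' := fun n c => by simp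
        smul_mem' := fun a y hy n c => by
          rw [smul_lie, hy, map_smul, mul_smul_comm, map_smul, smul_neg] }
    refine fun y => h.induction S (fun v hv n c => ?_) (fun x hx y hy n c => ?_) y
    · rw [eq_neg_iff_add_eq_zero]
      have hmem : ⁅v, X n c⁆ ∈ deg (n - 1) := by
        have := hU.lie_mem (-1) n v _ hv (hXdeg n c)
        rwa [neg_add_eq_sub] at this
      refine hU.eq_zero_of_forall_dual (add_mem hmem (hXdeg _ _)) fun f hf => ?_
      have hfd : f ∈ hU.dual h := ⟨n - 1, fun m hm Y hY => hf m (by omega) Y hY⟩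
      have e1 := hX (n - 1) (c * l' v) ⟨f, hfd⟩ hf
      have e2 := hX n c ⁅v, (⟨f, hfd⟩ : hU.dual h)⁆ fun m hm Y hY => by
        change (⁅v, f⁆ : Module.Dual 𝕜 U) Y = 0
        rw [Module.Dual.lie_apply, hf (-1 + m) (by omega) _ (hU.lie_mem (-1) m v Y hv hY), neg_zero]
      rw [hρl, smul_smul] at e2
      change (⁅v, f⁆ : Module.Dual 𝕜 U) (X n c) = _ at e2
      rw [Module.Dual.lie_apply] at e2
      change f _ = _ at e1
      rw [map_add, e1, ← e2]
      simp
    · have hx' : ∀ n c, ⁅x, X n c⁆ = -X (n - 1) (c * l' x) := hx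
      have hy' : ∀ n c, ⁅y, X n c⁆ = -X (n - 1) (c * l' y) := hy
      rw [lie_lie, hx', hy', lie_neg, lie_neg, hx', hy', hl', mul_assoc, mul_assoc,
        mul_comm (l' x)]
      simp
  refine ⟨K, _, _, hK, X, l', hXdeg, ?_, hl', hl'0, hrec⟩
  by_contra hcon
  push Not at hcon
  -- all functionals of the graded dual would be killed by `F ∘ π`
  obtain ⟨s, hs⟩ := hU.bounded_below
  have hker : ∀ n ≥ s - 1, ∀ f (hf : f ∈ dualFiltration deg n), F (π ⟨f, n, hf⟩) = 0 := by
    intro n hn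
    induction n, hn using Int.leInduction with
    | base =>
      intro f hf
      have hf0 : f = 0 := by
        have : (⊤ : Submodule 𝕜 U) ≤ LinearMap.ker f := by
          rw [← hU.iSup_eq_top]
          refine iSup_le fun m Y hY => ?_
          rcases lt_or_ge m s with hm | hm
          · rw [hs m hm, Submodule.mem_bot] at hY
            simp [hY]
          · exact hf m (by omega) Y hY
        exact LinearMap.ext fun Y => this (trivial : Y ∈ ⊤)
      subst hf0
      have : (⟨0, s - 1, hf⟩ : hU.dual h) = 0 := rfl
      rw [this, map_zero, map_zero]
    | succ n hn ih =>
      intro f hf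
      let g : Module.Dual 𝕜 (deg (n + 1)) := f ∘ₗ (deg (n + 1)).subtype
      have hsub : f - E (n + 1) g ∈ dualFiltration deg n := fun m hm Y hY => by
        rw [LinearMap.sub_apply, sub_eq_zero]
        rcases eq_or_ne m (n + 1) with rfl | hm'
        · exact (hE _ g ⟨Y, hY⟩).symm
        · rw [hf m (by omega) Y hY, hE' _ g m hm' Y hY]
      have e1 := ih _ hsub
      have e2 := hX (n + 1) 1 ⟨E (n + 1) g, n + 1, hEd _ g⟩ (hE' _ g)
      rw [hcon, map_zero, one_smul] at e2
      have : (⟨f, n + 1, hf⟩ : hU.dual h) =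
          ⟨f - E (n + 1) g, n, hsub⟩ + ⟨E (n + 1) g, n + 1, hEd _ g⟩ :=
        Subtype.ext (sub_add_cancel f _).symm
      rw [this, map_add, map_add, e1, ← e2, add_zero]
  obtain ⟨⟨f, n, hf⟩, rfl⟩ := hπ q
  exact hF (hker (max n (s - 1)) (le_max_right _ _) f (dualFiltration_mono (le_max_left _ _) hf))

/-- A graded module that is faithful in nonnegative degrees either vanishes in large degrees, or
contains elements `A c` of degree zero and `φ c` of degree `-1` with `[A c, y] = φ (l(y) c)`. -/
theorem IsGradedModule.eventually_eq_bot_or_exists_rankOne [CharZero 𝕜]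
    (hU : IsGradedModule 𝒢 deg) (h : IsFundamentalGNLA 𝕜 𝒢)
    (h0 : ∀ n ≥ 0, ∀ X ∈ deg n, (∀ y : L, ⁅y, X⁆ = 0) → X = 0) :
    (∃ n₀ : ℤ, ∀ n > n₀, deg n = ⊥) ∨
    ∃ (K : Type (max u w)) (_ : Field K) (_ : Algebra 𝕜 K) (_ : FiniteDimensional 𝕜 K)
      (φ A : K →ₗ[𝕜] U) (l : L →ₗ[𝕜] K), (∀ c, φ c ∈ deg (-1)) ∧ (∀ c, A c ∈ deg 0) ∧ φ ≠ 0 ∧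
      (∀ x y : L, l ⁅x, y⁆ = 0) ∧ l ≠ 0 ∧ ∀ (y : L) c, ⁅y, A c⁆ = -φ (c * l y) := by
  have hf0 : EventuallyFaithful 𝕜 (L := L) deg 0 :=
    ⟨-1, fun n hn X hX hy => h0 n (by omega) X hX fun y => hy y (by simp)⟩
  by_cases hf1 : EventuallyFaithful 𝕜 (L := L) deg 1
  · left
    have key : ∀ j, EventuallyFaithful 𝕜 (L := L) deg (j + 1) := fun j => by
      induction j with
      | zero => exact hf1
      | succ j ih => exact hU.eventuallyFaithful_succ h ih
    obtain ⟨j, hj⟩ := h.exists_lowerCentralSeries_eq_bot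
    have hj' : lowerCentralSeries 𝕜 L L (j + 1) = ⊥ := by
      rw [lowerCentralSeries_succ, hj, LieSubmodule.lie_bot]
    obtain ⟨n₀, hn₀⟩ := key j
    refine ⟨n₀, fun n hn => eq_bot_iff.mpr fun X hX => hn₀ n hn X hX fun y hy => ?_⟩
    rw [hj', LieSubmodule.mem_bot] at hy
    rw [hy, zero_lie]
  · right
    obtain ⟨K, _, _, hK, X, l, hXdeg, ⟨n, c, hne⟩, hl, hl0, hrec⟩ :=
      hU.exists_formal_eigenvector h hf0 hf1
    refine ⟨K, _, _, hK, X (-1), X 0, l, hXdeg _, hXdeg _, fun hX => hne ?_, hl, hl0,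
      fun y c => by simpa using hrec y 0 c⟩
    rcases le_or_gt (-1) n with hn | hn
    · clear hne
      induction n, hn using Int.leInduction generalizing c with
      | base => rw [hX, LinearMap.zero_apply]
      | succ n hn ih =>
        refine h0 (n + 1) (by omega) _ (hXdeg _ _) fun y => ?_
        rw [hrec, add_sub_cancel_right, ih, neg_zero]
    · obtain ⟨v, hv⟩ : ∃ v, l v ≠ 0 := by
        by_contra hcon
        push Not at hcon
        exact hl0 (LinearMap.ext hcon)
      have key : ∀ k : ℕ, ∀ c, X (-1 - k) c = 0 := fun k => by
        induction k with
        | zero => intro c; simp [hX]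
        | succ k ih =>
          intro c
          have := hrec v (-1 - k) (c * (l v)⁻¹)
          rw [ih, lie_zero, mul_assoc, inv_mul_cancel₀ hv, mul_one, eq_comm, neg_eq_zero] at this
          rw [← this]
          congr 2
          push_cast
          ring
      have := key (-1 - n).toNat c
      rwa [show (-1 - ((-1 - n).toNat : ℤ)) = n by omega] at this

end RankOne

/-! ### The Tanaka prolongation as a graded module -/

namespace Tanaka

section ProlongationModule

variable {𝕜 : Type u} [Field 𝕜] {L : Type v} [LieRing L] [LieAlgebra 𝕜 L]
    (𝒢 : ℤ → Submodule 𝕜 L) (g₀ : LieSubalgebra 𝕜 (Module.End 𝕜 (𝒢 (-1))))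

/-- The prolongation, to be regarded as a module over `L` with `[y, X] = -[X, y]`. -/
def ProlongationModule : Type v := Prolongation 𝒢 g₀

noncomputable instance : AddCommGroup (ProlongationModule 𝒢 g₀) :=
  inferInstanceAs (AddCommGroup (Prolongation 𝒢 g₀))

noncomputable instance : Module 𝕜 (ProlongationModule 𝒢 g₀) :=
  inferInstanceAs (Module 𝕜 (Prolongation 𝒢 g₀))

/-- The embedding of `L`. -/
noncomputable def negEmb : (negPart 𝕜 𝒢).carrier →ₗ[𝕜] ProlongationModule 𝒢 g₀ :=
  (LinearMap.inl 𝕜 L (zeroPart 𝒢 g₀ × DirectSum ℕ (fun k => posPart 𝒢 g₀ k)) :)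

/-- The embedding of `𝔤₀`. -/
noncomputable def zeroEmb : zeroPart 𝒢 g₀ →ₗ[𝕜] ProlongationModule 𝒢 g₀ :=
  (LinearMap.inr 𝕜 L (zeroPart 𝒢 g₀ × DirectSum ℕ (fun k => posPart 𝒢 g₀ k)) ∘ₗ
    LinearMap.inl 𝕜 _ _ :)

/-- The embedding of `𝔤ₖ₊₁`. -/
noncomputable def posEmb (k : ℕ) : posPart 𝒢 g₀ k →ₗ[𝕜] ProlongationModule 𝒢 g₀ :=
  (LinearMap.inr 𝕜 L (zeroPart 𝒢 g₀ × DirectSum ℕ (fun k => posPart 𝒢 g₀ k)) ∘ₗ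
    LinearMap.inr 𝕜 _ _ ∘ₗ DirectSum.lof 𝕜 ℕ (fun k => posPart 𝒢 g₀ k) k :)

/-- The embedding of the partial sum `L ⊕ 𝔤₀ ⊕ ⋯ ⊕ 𝔤ₖ`. -/
noncomputable def stageEmb : (k : ℕ) → (stage 𝒢 g₀ k).carrier →ₗ[𝕜] ProlongationModule 𝒢 g₀
  | 0 => LinearMap.coprod (negEmb 𝒢 g₀) (zeroEmb 𝒢 g₀)
  | k + 1 => LinearMap.coprod (stageEmb k) (posEmb 𝒢 g₀ k)

/-- The linear map on the prolongation with given restrictions to the summands. -/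
noncomputable def prolongationLift {M : Type*} [AddCommGroup M] [Module 𝕜 M]
    (f : (negPart 𝕜 𝒢).carrier →ₗ[𝕜] M) (g : zeroPart 𝒢 g₀ →ₗ[𝕜] M)
    (e : (k : ℕ) → posPart 𝒢 g₀ k →ₗ[𝕜] M) : ProlongationModule 𝒢 g₀ →ₗ[𝕜] M :=
  (LinearMap.coprod (show L →ₗ[𝕜] M from f) (LinearMap.coprod g (DirectSum.toModule 𝕜 ℕ M e)) :)

section Lift

variable {𝒢 g₀} {M : Type*} [AddCommGroup M] [Module 𝕜 M]
    (f : (negPart 𝕜 𝒢).carrier →ₗ[𝕜] M) (g : zeroPart 𝒢 g₀ →ₗ[𝕜] M)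
    (e : (k : ℕ) → posPart 𝒢 g₀ k →ₗ[𝕜] M)

theorem prolongationLift_negEmb (x : (negPart 𝕜 𝒢).carrier) :
    prolongationLift 𝒢 g₀ f g e (negEmb 𝒢 g₀ x) = f x :=
  LinearMap.congr_fun (LinearMap.coprod_inl (show L →ₗ[𝕜] M from f)
    (LinearMap.coprod g (DirectSum.toModule 𝕜 ℕ M e))) x

theorem prolongationLift_zeroEmb (w : zeroPart 𝒢 g₀) :
    prolongationLift 𝒢 g₀ f g e (zeroEmb 𝒢 g₀ w) = g w :=
  (LinearMap.congr_fun (LinearMap.coprod_inr (show L →ₗ[𝕜] M from f)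
    (LinearMap.coprod g (DirectSum.toModule 𝕜 ℕ M e))) (w, 0)).trans
    (LinearMap.congr_fun (LinearMap.coprod_inl g (DirectSum.toModule 𝕜 ℕ M e)) w)

theorem prolongationLift_posEmb (k : ℕ) (w : posPart 𝒢 g₀ k) :
    prolongationLift 𝒢 g₀ f g e (posEmb 𝒢 g₀ k w) = e k w :=
  (LinearMap.congr_fun (LinearMap.coprod_inr (show L →ₗ[𝕜] M from f)
    (LinearMap.coprod g (DirectSum.toModule 𝕜 ℕ M e))) (0, DirectSum.lof 𝕜 ℕ _ k w)).trans
    ((LinearMap.congr_fun (LinearMap.coprod_inr g (DirectSum.toModule 𝕜 ℕ M e))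
      (DirectSum.lof 𝕜 ℕ _ k w)).trans (DirectSum.toModule_lof (M := fun k => posPart 𝒢 g₀ k)
        (φ := e) 𝕜 k w))

end Lift

/-- The summands span the prolongation. -/
theorem prolongation_induction {p : ProlongationModule 𝒢 g₀ → Prop} (X : ProlongationModule 𝒢 g₀)
    (hadd : ∀ X Y, p X → p Y → p (X + Y)) (hneg : ∀ x, p (negEmb 𝒢 g₀ x))
    (hzero : ∀ w, p (zeroEmb 𝒢 g₀ w)) (hpos : ∀ k w, p (posEmb 𝒢 g₀ k w)) : p X := by
  obtain ⟨x, w, s⟩ := X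
  have hs : p ((0, 0, s) : Prolongation 𝒢 g₀) := by
    induction s using DirectSum.induction_on with
    | zero => exact hneg 0
    | of k w => exact hpos k w
    | add s t hs ht =>
      have : ((0, 0, s + t) : Prolongation 𝒢 g₀) = (0, 0, s) + (0, 0, t) := by simp
      rw [this]
      exact hadd _ _ hs ht
  have : ((x, w, s) : Prolongation 𝒢 g₀) = (x, 0, 0) + ((0, w, 0) + (0, 0, s)) := by simp
  rw [this]
  exact hadd _ _ (hneg x) (hadd _ _ (hzero w) hs)

/-- The operation `[X, y]` for `X` in the prolongation and `y ∈ L`. -/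
noncomputable def prolongationAct :
    ProlongationModule 𝒢 g₀ →ₗ[𝕜] L →ₗ[𝕜] ProlongationModule 𝒢 g₀ :=
  prolongationLift 𝒢 g₀
    (LinearMap.compRight 𝕜 (negEmb 𝒢 g₀) ∘ₗ (negPart 𝕜 𝒢).act)
    (LinearMap.compRight 𝕜 (negEmb 𝒢 g₀) ∘ₗ (zeroPart 𝒢 g₀).subtype)
    (fun k => LinearMap.compRight 𝕜 (stageEmb 𝒢 g₀ k) ∘ₗ (posPart 𝒢 g₀ k).subtype)

theorem prolongationAct_negEmb (x : (negPart 𝕜 𝒢).carrier) (y : L) :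
    prolongationAct 𝒢 g₀ (negEmb 𝒢 g₀ x) y = negEmb 𝒢 g₀ ((negPart 𝕜 𝒢).act x y) := by
  rw [prolongationAct, prolongationLift_negEmb]
  rfl

theorem prolongationAct_zeroEmb (w : zeroPart 𝒢 g₀) (y : L) :
    prolongationAct 𝒢 g₀ (zeroEmb 𝒢 g₀ w) y =
      negEmb 𝒢 g₀ ((w : L →ₗ[𝕜] (negPart 𝕜 𝒢).carrier) y) := by
  rw [prolongationAct, prolongationLift_zeroEmb]
  rfl

theorem prolongationAct_posEmb (k : ℕ) (w : posPart 𝒢 g₀ k) (y : L) :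
    prolongationAct 𝒢 g₀ (posEmb 𝒢 g₀ k w) y =
      stageEmb 𝒢 g₀ k ((w : L →ₗ[𝕜] (stage 𝒢 g₀ k).carrier) y) := by
  rw [prolongationAct, prolongationLift_posEmb]
  rfl

theorem prolongationAct_stageEmb (k : ℕ) (e : (stage 𝒢 g₀ k).carrier) (y : L) :
    prolongationAct 𝒢 g₀ (stageEmb 𝒢 g₀ k e) y = stageEmb 𝒢 g₀ k ((stage 𝒢 g₀ k).act e y) := by
  induction k with
  | zero =>
    obtain ⟨x, w⟩ := e
    change prolongationAct 𝒢 g₀ (negEmb 𝒢 g₀ x + zeroEmb 𝒢 g₀ w) y =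
      negEmb 𝒢 g₀ ((negPart 𝕜 𝒢).act x y + (w : L →ₗ[𝕜] (negPart 𝕜 𝒢).carrier) y) +
        zeroEmb 𝒢 g₀ 0
    rw [map_add, LinearMap.add_apply, prolongationAct_negEmb, prolongationAct_zeroEmb, map_add,
      map_zero, add_zero]
  | succ k ih =>
    obtain ⟨x, w⟩ := e
    change prolongationAct 𝒢 g₀ (stageEmb 𝒢 g₀ k x + posEmb 𝒢 g₀ k w) y =
      stageEmb 𝒢 g₀ k ((stage 𝒢 g₀ k).act x y +
        (w : L →ₗ[𝕜] (stage 𝒢 g₀ k).carrier) y) + posEmb 𝒢 g₀ k 0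
    rw [map_add, LinearMap.add_apply, ih, prolongationAct_posEmb, map_add, map_zero, add_zero]

theorem prolongationAct_lie (X : ProlongationModule 𝒢 g₀) (x y : L) :
    prolongationAct 𝒢 g₀ X ⁅x, y⁆ = prolongationAct 𝒢 g₀ (prolongationAct 𝒢 g₀ X x) y -
      prolongationAct 𝒢 g₀ (prolongationAct 𝒢 g₀ X y) x := by
  induction X using prolongation_induction with
  | hadd X Y hX hY => simp only [map_add, LinearMap.add_apply, hX, hY]; abel
  | hneg z =>
    simp only [prolongationAct_negEmb]
    rw [← map_sub]
    congr 1
    let z' : L := z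
    change ⁅z', ⁅x, y⁆⁆ = ⁅⁅z', x⁆, y⁆ - ⁅⁅z', y⁆, x⁆
    rw [leibniz_lie, ← lie_skew x, sub_eq_add_neg]
  | hzero w =>
    simp only [prolongationAct_zeroEmb, prolongationAct_negEmb]
    rw [w.2.1.2 x y, map_sub]
  | hpos k w =>
    simp only [prolongationAct_posEmb, prolongationAct_stageEmb]
    rw [w.2.2 x y, map_sub]

noncomputable instance : LieRingModule L (ProlongationModule 𝒢 g₀) where
  bracket y X := -prolongationAct 𝒢 g₀ X y
  add_lie x y X := by rw [map_add, neg_add]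
  lie_add x X Y := by rw [map_add, LinearMap.add_apply, neg_add]
  leibniz_lie x y X := by
    rw [prolongationAct_lie]
    simp only [map_neg, LinearMap.neg_apply]
    abel

theorem ProlongationModule.lie_def (y : L) (X : ProlongationModule 𝒢 g₀) :
    ⁅y, X⁆ = -prolongationAct 𝒢 g₀ X y := rfl

noncomputable instance : LieModule 𝕜 L (ProlongationModule 𝒢 g₀) where
  smul_lie t x X := by
    simp only [ProlongationModule.lie_def]
    rw [map_smul, smul_neg]
  lie_smul t x X := by
    simp only [ProlongationModule.lie_def]
    rw [map_smul, LinearMap.smul_apply, smul_neg]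

/-- The homogeneous component of degree `n` of the prolongation. -/
noncomputable def prolongationDeg (n : ℤ) : Submodule 𝕜 (ProlongationModule 𝒢 g₀) :=
  ((negPart 𝕜 𝒢).deg n).map (negEmb 𝒢 g₀) ⊔
    ((⨆ _ : n = 0, LinearMap.range (zeroEmb 𝒢 g₀)) ⊔
      ⨆ (k : ℕ) (_ : n = k + 1), LinearMap.range (posEmb 𝒢 g₀ k))

variable {𝒢 g₀}

theorem negEmb_mem_prolongationDeg {n : ℤ} {x : (negPart 𝕜 𝒢).carrier}
    (hx : x ∈ (negPart 𝕜 𝒢).deg n) : negEmb 𝒢 g₀ x ∈ prolongationDeg 𝒢 g₀ n :=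
  Submodule.mem_sup_left (Submodule.mem_map_of_mem hx)

theorem zeroEmb_mem_prolongationDeg (w : zeroPart 𝒢 g₀) :
    zeroEmb 𝒢 g₀ w ∈ prolongationDeg 𝒢 g₀ 0 :=
  Submodule.mem_sup_right (Submodule.mem_sup_left
    (Submodule.mem_iSup_of_mem rfl (LinearMap.mem_range_self _ w)))

theorem posEmb_mem_prolongationDeg (k : ℕ) (w : posPart 𝒢 g₀ k) :
    posEmb 𝒢 g₀ k w ∈ prolongationDeg 𝒢 g₀ (k + 1) :=
  Submodule.mem_sup_right (Submodule.mem_sup_right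
    (Submodule.mem_iSup_of_mem k (Submodule.mem_iSup_of_mem rfl (LinearMap.mem_range_self _ w))))

theorem prolongationDeg_le {n : ℤ} {P : Submodule 𝕜 (ProlongationModule 𝒢 g₀)}
    (hneg : ∀ x ∈ (negPart 𝕜 𝒢).deg n, negEmb 𝒢 g₀ x ∈ P)
    (hzero : n = 0 → ∀ w, zeroEmb 𝒢 g₀ w ∈ P)
    (hpos : ∀ k : ℕ, n = k + 1 → ∀ w, posEmb 𝒢 g₀ k w ∈ P) : prolongationDeg 𝒢 g₀ n ≤ P := by
  refine sup_le (Submodule.map_le_iff_le_comap.mpr hneg) (sup_le (iSup_le fun hn => ?_)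
    (iSup₂_le fun k hk => ?_))
  · rintro _ ⟨w, rfl⟩
    exact hzero hn w
  · rintro _ ⟨w, rfl⟩
    exact hpos k hk w

theorem stageEmb_mem_prolongationDeg (k : ℕ) (n : ℤ) (e : (stage 𝒢 g₀ k).carrier)
    (he : e ∈ (stage 𝒢 g₀ k).deg n) : stageEmb 𝒢 g₀ k e ∈ prolongationDeg 𝒢 g₀ n := by
  induction k with
  | zero =>
    obtain ⟨x, w⟩ := e
    have he' : x ∈ (negPart 𝕜 𝒢).deg n ∧
      w ∈ (if n = 0 then ⊤ else ⊥ : Submodule 𝕜 (zeroPart 𝒢 g₀)) := he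
    refine add_mem (negEmb_mem_prolongationDeg he'.1) ?_
    by_cases hn : n = 0
    · subst hn
      exact zeroEmb_mem_prolongationDeg w
    · have hw := he'.2
      rw [if_neg hn, Submodule.mem_bot] at hw
      rw [hw]
      exact (map_zero (zeroEmb 𝒢 g₀)).symm ▸ zero_mem _
  | succ k ih =>
    obtain ⟨x, w⟩ := e
    have he' : x ∈ (stage 𝒢 g₀ k).deg n ∧
      w ∈ (if n = k + 1 then ⊤ else ⊥ : Submodule 𝕜 (posPart 𝒢 g₀ k)) := he
    refine add_mem (ih x he'.1) ?_
    by_cases hn : n = k + 1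
    · subst hn
      exact posEmb_mem_prolongationDeg k w
    · have hw := he'.2
      rw [if_neg hn, Submodule.mem_bot] at hw
      rw [hw]
      exact (map_zero (posEmb 𝒢 g₀ k)).symm ▸ zero_mem _

end ProlongationModule

end Tanaka

namespace Tanaka

section ProlongationGrading

variable {𝕜 : Type u} [Field 𝕜] {L : Type v} [LieRing L] [LieAlgebra 𝕜 L]
    {𝒢 : ℤ → Submodule 𝕜 L} {g₀ : LieSubalgebra 𝕜 (Module.End 𝕜 (𝒢 (-1)))}

theorem negEmb_injective : Function.Injective (negEmb 𝒢 g₀) :=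
  fun _ _ h => LinearMap.inl_injective (R := 𝕜) (M := L)
    (M₂ := zeroPart 𝒢 g₀ × DirectSum ℕ (fun k => posPart 𝒢 g₀ k)) h

theorem negEmb_eq_zero {n : ℤ} (hn : 𝒢 n = ⊥) {x : L} (hx : x ∈ 𝒢 n) : negEmb 𝒢 g₀ x = 0 := by
  rw [hn, Submodule.mem_bot] at hx
  rw [hx]
  exact map_zero (negEmb 𝒢 g₀)

theorem stageEmb_injective (k : ℕ) : Function.Injective (stageEmb 𝒢 g₀ k) := by
  -- the projections onto the components of positive degree
  let c : (k : ℕ) → ProlongationModule 𝒢 g₀ →ₗ[𝕜] posPart 𝒢 g₀ k := fun k =>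
    prolongationLift 𝒢 g₀ 0 0 fun i => DirectSum.component 𝕜 ℕ (fun k => posPart 𝒢 g₀ k) k ∘ₗ
      DirectSum.lof 𝕜 ℕ (fun k => posPart 𝒢 g₀ k) i
  have hc0 : ∀ j i, j ≤ i → ∀ e, c i (stageEmb 𝒢 g₀ j e) = 0 := by
    intro j
    induction j with
    | zero =>
      rintro i - ⟨x, w⟩
      change c i (negEmb 𝒢 g₀ x + zeroEmb 𝒢 g₀ w) = 0
      rw [map_add, prolongationLift_negEmb, prolongationLift_zeroEmb]
      simp
    | succ j ih =>
      rintro i hi ⟨x, w⟩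
      change c i (stageEmb 𝒢 g₀ j x + posEmb 𝒢 g₀ j w) = 0
      rw [map_add, ih i (by omega), prolongationLift_posEmb, zero_add]
      rw [DirectSum.component_comp_lof, dif_neg (by omega)]
      rfl
  rw [injective_iff_map_eq_zero]
  induction k with
  | zero =>
    rintro ⟨x, w⟩ h
    change negEmb 𝒢 g₀ x + zeroEmb 𝒢 g₀ w = 0 at h
    have hw : w = 0 := by
      have := congrArg (prolongationLift 𝒢 g₀ 0 LinearMap.id fun _ => 0) h
      rwa [map_add, prolongationLift_negEmb, prolongationLift_zeroEmb, map_zero,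
        LinearMap.zero_apply, zero_add] at this
    subst hw
    rw [map_zero, add_zero] at h
    rw [negEmb_injective (h.trans (map_zero (negEmb 𝒢 g₀)).symm)]
    rfl
  | succ k ih =>
    rintro ⟨x, w⟩ h
    change stageEmb 𝒢 g₀ k x + posEmb 𝒢 g₀ k w = 0 at h
    have hw : w = 0 := by
      have := congrArg (c k) h
      rw [map_add, hc0 k k le_rfl, zero_add, prolongationLift_posEmb, map_zero] at this
      simpa using this
    subst hw
    rw [map_zero, add_zero] at h
    rw [ih x h]
    rfl

theorem finiteDimensional_stage [FiniteDimensional 𝕜 L] (k : ℕ) :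
    FiniteDimensional 𝕜 (stage 𝒢 g₀ k).carrier := by
  induction k with
  | zero =>
    have : FiniteDimensional 𝕜 (negPart 𝕜 𝒢).carrier := inferInstanceAs (FiniteDimensional 𝕜 L)
    exact inferInstanceAs (FiniteDimensional 𝕜 ((negPart 𝕜 𝒢).carrier × zeroPart 𝒢 g₀))
  | succ k ih =>
    exact inferInstanceAs (FiniteDimensional 𝕜 ((stage 𝒢 g₀ k).carrier × posPart 𝒢 g₀ k))

theorem negEmb_mem_range_stageEmb (k : ℕ) (x : (negPart 𝕜 𝒢).carrier) :
    negEmb 𝒢 g₀ x ∈ LinearMap.range (stageEmb 𝒢 g₀ k) := by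
  induction k with
  | zero =>
    exact ⟨(x, 0), (congrArg _ (map_zero (zeroEmb 𝒢 g₀))).trans (add_zero (negEmb 𝒢 g₀ x))⟩
  | succ k ih =>
    obtain ⟨e, he⟩ := ih
    refine ⟨(e, 0), Eq.trans ?_ he⟩
    exact (congrArg _ (map_zero (posEmb 𝒢 g₀ k))).trans (add_zero _)

/-- The prolongation is a graded module. -/
theorem isGradedModule_prolongationDeg (h : IsFundamentalGNLA 𝕜 𝒢) :
    IsGradedModule 𝒢 (prolongationDeg 𝒢 g₀) where
  finiteDimensional n := by
    have := h.finiteDimensional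
    have hst := finiteDimensional_stage (𝒢 := 𝒢) (g₀ := g₀)
    rcases lt_trichotomy n 0 with hn | rfl | hn
    · refine Submodule.finiteDimensional_of_le (S₂ := LinearMap.range (stageEmb 𝒢 g₀ 0)) <|
        prolongationDeg_le (fun x _ => negEmb_mem_range_stageEmb 0 x) (by omega) (by omega)
    · refine Submodule.finiteDimensional_of_le (S₂ := LinearMap.range (stageEmb 𝒢 g₀ 0)) <|
        prolongationDeg_le (fun x _ => negEmb_mem_range_stageEmb 0 x) (fun _ w => ?_) (by omega)
      exact ⟨(0, w), (congrArg (· + _) (map_zero (negEmb 𝒢 g₀))).trans (zero_add _)⟩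
    · refine Submodule.finiteDimensional_of_le (S₂ := LinearMap.range (stageEmb 𝒢 g₀ n.toNat)) <|
        prolongationDeg_le (fun x _ => negEmb_mem_range_stageEmb _ x) (by omega) fun k hk w => ?_
      obtain rfl : n = ((k + 1 : ℕ) : ℤ) := by push_cast; exact hk
      rw [Int.toNat_natCast]
      exact ⟨(0, w), (congrArg (· + _) (map_zero (stageEmb 𝒢 g₀ k))).trans (zero_add _)⟩
  bounded_below := by
    obtain ⟨s, hs⟩ := h.exists_forall_lt_eq_bot
    refine ⟨min s 0, fun n hn => eq_bot_iff.mpr (prolongationDeg_le (fun x hx => ?_)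
      (by omega) (by omega))⟩
    exact negEmb_eq_zero (hs n (by omega)) hx
  iSupIndep := by
    intro m
    obtain ⟨p, hp, hp'⟩ := exists_projection_of_iSupIndep h.isInternal.submodule_iSupIndep
      h.isInternal.submodule_iSup_eq_top m
    -- the projection onto the component of degree `m`
    let d : ProlongationModule 𝒢 g₀ →ₗ[𝕜] ProlongationModule 𝒢 g₀ :=
      prolongationLift 𝒢 g₀ (negEmb 𝒢 g₀ ∘ₗ (show L →ₗ[𝕜] L from (𝒢 m).subtype ∘ₗ p))
        (if m = 0 then zeroEmb 𝒢 g₀ else 0)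
        (fun k => if m = k + 1 then posEmb 𝒢 g₀ k else 0)
    have h1 : prolongationDeg 𝒢 g₀ m ≤ LinearMap.ker (d - LinearMap.id) := by
      refine prolongationDeg_le (fun x hx => ?_) (fun hm w => ?_) (fun k hk w => ?_)
      · rw [LinearMap.mem_ker, LinearMap.sub_apply, prolongationLift_negEmb, sub_eq_zero]
        exact congrArg (negEmb 𝒢 g₀) (congrArg Subtype.val (hp ⟨x, hx⟩))
      · rw [LinearMap.mem_ker, LinearMap.sub_apply, prolongationLift_zeroEmb, if_pos hm]
        exact sub_self _
      · rw [LinearMap.mem_ker, LinearMap.sub_apply, prolongationLift_posEmb, if_pos hk]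
        exact sub_self _
    have h2 : ⨆ (j) (_ : j ≠ m), prolongationDeg 𝒢 g₀ j ≤ LinearMap.ker d := by
      refine iSup₂_le fun j hj => prolongationDeg_le (fun x hx => ?_) (fun hm w => ?_)
        (fun k hk w => ?_)
      · rw [LinearMap.mem_ker, prolongationLift_negEmb]
        exact (congrArg (negEmb 𝒢 g₀) (congrArg Subtype.val (hp' j hj x hx))).trans
          (map_zero (negEmb 𝒢 g₀))
      · rw [LinearMap.mem_ker, prolongationLift_zeroEmb, if_neg (by omega)]
        rfl
      · rw [LinearMap.mem_ker, prolongationLift_posEmb, if_neg (by omega)]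
        rfl
    rw [Submodule.disjoint_def]
    intro X hX hX'
    have e1 : d X = X := sub_eq_zero.mp (h1 hX)
    rw [← e1]
    exact h2 hX'
  iSup_eq_top := by
    rw [eq_top_iff]
    rintro X -
    induction X using prolongation_induction with
    | hadd X Y hX hY => exact add_mem hX hY
    | hneg x =>
      have hx : (show L from x) ∈ ⨆ n, 𝒢 n := by
        rw [h.isInternal.submodule_iSup_eq_top]; trivial
      have : (⨆ n, 𝒢 n : Submodule 𝕜 L) ≤
          (⨆ n, prolongationDeg 𝒢 g₀ n).comap (show L →ₗ[𝕜] _ from negEmb 𝒢 g₀) :=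
        iSup_le fun n x hx => Submodule.mem_iSup_of_mem n (negEmb_mem_prolongationDeg hx)
      exact this hx
    | hzero w => exact Submodule.mem_iSup_of_mem 0 (zeroEmb_mem_prolongationDeg w)
    | hpos k w => exact Submodule.mem_iSup_of_mem (k + 1) (posEmb_mem_prolongationDeg k w)
  lie_mem i j y X hy hX := by
    rw [ProlongationModule.lie_def, neg_mem_iff]
    have : prolongationDeg 𝒢 g₀ j ≤
        (prolongationDeg 𝒢 g₀ (i + j)).comap ((prolongationAct 𝒢 g₀).flip y) := by
      refine prolongationDeg_le (fun x hx => ?_) (fun hj w => ?_) (fun k hk w => ?_)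
      · rw [Submodule.mem_comap, LinearMap.flip_apply, prolongationAct_negEmb]
        refine negEmb_mem_prolongationDeg ?_
        rw [add_comm]
        exact h.lie_mem j i x y hx hy
      · rw [Submodule.mem_comap, LinearMap.flip_apply, prolongationAct_zeroEmb, hj]
        exact negEmb_mem_prolongationDeg (w.2.1.1 i y hy)
      · rw [Submodule.mem_comap, LinearMap.flip_apply, prolongationAct_posEmb, hk]
        exact stageEmb_mem_prolongationDeg k _ _ (w.2.1 i y hy)
    exact this hX

theorem prolongationDeg_zero_le (h : IsFundamentalGNLA 𝕜 𝒢) :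
    prolongationDeg 𝒢 g₀ 0 ≤ LinearMap.range (zeroEmb 𝒢 g₀) := by
  refine prolongationDeg_le (fun x hx => ?_) (fun _ w => ⟨w, rfl⟩) (by omega)
  exact (negEmb_eq_zero (h.eq_bot_of_nonneg 0 le_rfl) hx).symm ▸ zero_mem _

theorem prolongationDeg_succ_le (h : IsFundamentalGNLA 𝕜 𝒢) (k : ℕ) :
    prolongationDeg 𝒢 g₀ (k + 1) ≤ LinearMap.range (posEmb 𝒢 g₀ k) := by
  refine prolongationDeg_le (fun x hx => ?_) (by omega) (fun i hi w => ?_)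
  · exact (negEmb_eq_zero (h.eq_bot_of_nonneg _ (by omega)) hx).symm ▸ zero_mem _
  · obtain rfl : k = i := by omega
    exact ⟨w, rfl⟩

/-- Elements of nonnegative degree are determined by their brackets with `L`. -/
theorem eq_zero_of_forall_lie_eq_zero (h : IsFundamentalGNLA 𝕜 𝒢) {n : ℤ} (hn : 0 ≤ n)
    {X : ProlongationModule 𝒢 g₀} (hX : X ∈ prolongationDeg 𝒢 g₀ n)
    (hy : ∀ y : L, ⁅y, X⁆ = 0) : X = 0 := by
  obtain ⟨k, rfl⟩ := Int.eq_ofNat_of_zero_le hn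
  cases k with
  | zero =>
    obtain ⟨w, rfl⟩ := prolongationDeg_zero_le h hX
    have : w = 0 := Subtype.ext <| LinearMap.ext fun y => negEmb_injective (g₀ := g₀) <| by
      have := hy y
      rw [ProlongationModule.lie_def, neg_eq_zero, prolongationAct_zeroEmb] at this
      exact this.trans (map_zero _).symm
    rw [this, map_zero]
  | succ k =>
    obtain ⟨w, rfl⟩ := prolongationDeg_succ_le h k (by exact_mod_cast hX)
    have : w = 0 := Subtype.ext <| LinearMap.ext fun y => stageEmb_injective k <| by
      have := hy y
      rw [ProlongationModule.lie_def, neg_eq_zero, prolongationAct_posEmb] at this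
      exact this.trans (map_zero _).symm
    rw [this, map_zero]

/-- If the prolongation is infinite-dimensional, then over some finite extension `K` of `𝕜` there
are a nonzero `φ : K → 𝔤₋₁` and a nonzero character `l : L → K` such that all the maps
`y ↦ φ (c l(y))` are derivations of `L`. Such derivations are of rank one over `K`. -/
theorem finiteDimensional_or_exists_rankOne [CharZero 𝕜] (h : IsFundamentalGNLA 𝕜 𝒢) :
    FiniteDimensional 𝕜 (Prolongation 𝒢 g₀) ∨
    ∃ (K : Type (max u v)) (_ : Field K) (_ : Algebra 𝕜 K) (_ : FiniteDimensional 𝕜 K)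
      (φ : K →ₗ[𝕜] L) (l : L →ₗ[𝕜] K), (∀ c, φ c ∈ 𝒢 (-1)) ∧ φ ≠ 0 ∧ l ≠ 0 ∧
        (∀ x y : L, l ⁅x, y⁆ = 0) ∧ ∀ c x y, ⁅φ (c * l x), y⁆ = ⁅φ (c * l y), x⁆ := by
  have hU := isGradedModule_prolongationDeg (g₀ := g₀) h
  rcases hU.eventually_eq_bot_or_exists_rankOne h
    (fun n hn X hX => eq_zero_of_forall_lie_eq_zero h hn hX) with hfin |
    ⟨K, _, _, hK, Φ, A, l, hΦ, hA, hΦ0, hl, hl0, hrec⟩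
  · exact Or.inl (hU.finiteDimensional_of_eventually_eq_bot hfin)
  right
  let r : ProlongationModule 𝒢 g₀ →ₗ[𝕜] L :=
    prolongationLift 𝒢 g₀ (show L →ₗ[𝕜] L from LinearMap.id) 0 0
  have hneg : prolongationDeg 𝒢 g₀ (-1) ≤ ((negPart 𝕜 𝒢).deg (-1)).map (negEmb 𝒢 g₀) :=
    prolongationDeg_le (fun x hx => Submodule.mem_map_of_mem hx) (by omega) (by omega)
  have hr : ∀ c, r (Φ c) ∈ 𝒢 (-1) ∧ negEmb 𝒢 g₀ (r (Φ c)) = Φ c := fun c => by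
    obtain ⟨x, hx, hxc⟩ := hneg (hΦ c)
    have : r (Φ c) = x := by
      rw [← hxc]
      exact prolongationLift_negEmb _ _ _ x
    rw [this]
    exact ⟨hx, hxc⟩
  refine ⟨K, _, _, hK, r ∘ₗ Φ, l, fun c => (hr c).1, fun h0 => hΦ0 ?_, hl0, hl, fun c x y => ?_⟩
  · ext c
    rw [← (hr c).2, show r (Φ c) = 0 from LinearMap.congr_fun h0 c]
    exact map_zero (negEmb 𝒢 g₀)
  · obtain ⟨w, hw⟩ := prolongationDeg_zero_le h (hA c)
    have hwφ : ∀ y, (w : L →ₗ[𝕜] (negPart 𝕜 𝒢).carrier) y = r (Φ (c * l y)) := fun y => by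
      apply negEmb_injective (g₀ := g₀)
      have := hrec y c
      rw [← hw, ProlongationModule.lie_def, neg_inj, prolongationAct_zeroEmb] at this
      rw [this, (hr _).2]
    have := w.2.1.2 x y
    rw [hwφ, hwφ, hwφ, hl, mul_zero, map_zero, map_zero] at this
    have h' : (0 : L) = ⁅r (Φ (c * l x)), y⁆ - ⁅r (Φ (c * l y)), x⁆ := this
    exact sub_eq_zero.mp h'.symm

end ProlongationGrading

end Tanaka

/-! ### Exponentials of derivations -/

open NormedSpace in
theorem exp_smul_mul_exp_neg_smul {𝕜 A : Type*} [RCLike 𝕜] [NormedRing A] [NormedAlgebra 𝕜 A]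
    [CompleteSpace A] (a : A) (t : 𝕜) : exp (t • a) * exp (-t • a) = 1 := by
  have hmem : ∀ x : A, x ∈ Metric.eball (0 : A) (expSeries 𝕜 A).radius := fun x =>
    (expSeries_radius_eq_top 𝕜 A).symm ▸ edist_lt_top _ _
  rw [← exp_add_of_commute_of_mem_ball (𝕂 := 𝕜) (((Commute.refl a).smul_left t).smul_right (-t))
    (hmem _) (hmem _), neg_smul, add_neg_cancel, exp_zero]

open NormedSpace in
/-- The exponential of a derivation of a bilinear operation is an automorphism of it. -/
theorem exp_apply_bilin_of_derivation {𝕜 E : Type*} [RCLike 𝕜] [NormedAddCommGroup E]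
    [NormedSpace 𝕜 E] [CompleteSpace E] (b : E →L[𝕜] E →L[𝕜] E) (T : E →L[𝕜] E)
    (hT : ∀ x y, T (b x y) = b (T x) y + b x (T y)) (t : 𝕜) (x y : E) :
    exp (t • T) (b x y) = b (exp (t • T) x) (exp (t • T) y) := by
  have hexp : ∀ (z : E) (t : 𝕜), HasDerivAt (fun t : 𝕜 => exp (t • T) z) (T (exp (t • T) z)) t :=
    fun z t => by
      have := (hasDerivAt_exp_smul_const' (𝕂 := 𝕜) T t).clm_apply (hasDerivAt_const t z)
      simpa using this
  have hexp' : ∀ t : 𝕜, HasDerivAt (fun t : 𝕜 => exp (t • -T)) (-(exp (t • -T) * T)) t :=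
    fun t => by
    have := hasDerivAt_exp_smul_const (𝕂 := 𝕜) (-T) t
    simpa using this
  -- `t ↦ exp (-tT) b (exp (tT) x) (exp (tT) y)` has derivative zero
  have hderiv : ∀ t : 𝕜, HasDerivAt
      (fun t : 𝕜 => exp (t • -T) (b (exp (t • T) x) (exp (t • T) y))) 0 t := fun t => by
    have h1 : HasDerivAt (fun t : 𝕜 => b (exp (t • T) x)) (b (T (exp (t • T) x))) t :=
      b.hasFDerivAt.comp_hasDerivAt t (hexp x t)
    have h2 := (hexp' t).clm_apply (h1.clm_apply (hexp y t))
    convert h2 using 1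
    simp only [neg_apply, mul_apply_eq_comp, hT, map_add]
    abel
  have hconst := is_const_of_deriv_eq_zero (𝕜 := 𝕜)
    (fun t => (hderiv t).differentiableAt) (fun t => (hderiv t).deriv) t 0
  have h0 : exp (t • -T) (b (exp (t • T) x) (exp (t • T) y)) = b x y := by
    simpa using hconst
  have hinv : exp (t • T) * exp (t • -T) = 1 := by
    rw [smul_neg, ← neg_smul]
    exact exp_smul_mul_exp_neg_smul T t
  rw [← h0]
  exact DFunLike.congr_fun hinv _

open NormedSpace in
/-- Invariant subspaces of an operator are invariant under its exponential. -/
theorem exp_apply_mem {𝕜 E : Type*} [RCLike 𝕜] [NormedAddCommGroup E]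
    [NormedSpace 𝕜 E] [FiniteDimensional 𝕜 E] (T : E →L[𝕜] E) (V : Submodule 𝕜 E)
    (hV : ∀ x ∈ V, T x ∈ V) {x : E} (hx : x ∈ V) : exp T x ∈ V := by
  have : CompleteSpace E := FiniteDimensional.complete 𝕜 E
  have hs := (exp_series_hasSum_exp' (𝕂 := 𝕜) T).mapL
    (ContinuousLinearMap.apply 𝕜 E x)
  have hpow : ∀ n : ℕ, (T ^ n) x ∈ V := fun n => by
    induction n with
    | zero => simpa using hx
    | succ n ih => rw [pow_succ']; exact hV _ ih
  refine V.closed_of_finiteDimensional.mem_of_tendsto hs (Filter.Eventually.of_forall fun s => ?_)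
  exact sum_mem fun n _ => V.smul_mem _ (hpow n)

open NormedSpace in
/-- A subspace that is invariant under all automorphisms of a Lie algebra preserving `V` is
invariant under all derivations preserving `V`. -/
theorem LieDerivation.apply_mem_of_forall_lieEquiv {𝕜 L : Type*} [RCLike 𝕜] [LieRing L]
    [LieAlgebra 𝕜 L] [FiniteDimensional 𝕜 L] (D : LieDerivation 𝕜 L L) (V N : Submodule 𝕜 L)
    (hV : ∀ x ∈ V, D x ∈ V)
    (hN : ∀ e : L ≃ₗ⁅𝕜⁆ L, (∀ x ∈ V, e x ∈ V) → ∀ x ∈ N, e x ∈ N) {x : L} (hx : x ∈ N) :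
    D x ∈ N := by
  let f := (Module.finBasis 𝕜 L).equivFun
  let _ : NormedAddCommGroup L := NormedAddCommGroup.induced L _ f.toLinearMap f.injective
  let _ : NormedSpace 𝕜 L := NormedSpace.induced 𝕜 L _ f.toLinearMap
  have : CompleteSpace L := FiniteDimensional.complete 𝕜 L
  let T : L →L[𝕜] L := LinearMap.toContinuousLinearMap (D : L →ₗ[𝕜] L)
  let b : L →L[𝕜] L →L[𝕜] L := LinearMap.toContinuousLinearMap
    ((LinearMap.toContinuousLinearMap : (L →ₗ[𝕜] L) ≃ₗ[𝕜] L →L[𝕜] L).toLinearMap ∘ₗ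
      (LieAlgebra.ad 𝕜 L : L →ₗ[𝕜] Module.End 𝕜 L))
  have hexp : ∀ (t : 𝕜) (x y : L), NormedSpace.exp (t • T) ⁅x, y⁆ =
      ⁅NormedSpace.exp (t • T) x, NormedSpace.exp (t • T) y⁆ :=
    exp_apply_bilin_of_derivation b T fun x y => by
      change D ⁅x, y⁆ = ⁅D x, y⁆ + ⁅x, D y⁆
      rw [LieDerivation.apply_lie_eq_add, add_comm]
  have hinv : ∀ t : 𝕜, NormedSpace.exp (t • T) * NormedSpace.exp (-t • T) = 1 :=
    exp_smul_mul_exp_neg_smul T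
  let e : 𝕜 → L ≃ₗ⁅𝕜⁆ L := fun t =>
    { (NormedSpace.exp (t • T) : L →L[𝕜] L).toLinearMap with
      map_lie' := fun {x y} => hexp t x y
      invFun := ⇑(NormedSpace.exp (-t • T) : L →L[𝕜] L)
      left_inv := fun x => by
        have := hinv (-t)
        rw [neg_neg] at this
        exact DFunLike.congr_fun this x
      right_inv := fun x => DFunLike.congr_fun (hinv t) x }
  have hmem : ∀ t : 𝕜, NormedSpace.exp (t • T) x ∈ N := fun t =>
    hN (e t) (fun y hy => exp_apply_mem (t • T) V (fun z hz => V.smul_mem t (hV z hz)) hy) x hx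
  by_contra hD
  -- a functional that vanishes on `N` has derivative zero along the curve `NormedSpace.exp (tD) x`
  obtain ⟨g, hg, hgN⟩ := Submodule.exists_le_ker_of_notMem hD
  have hd : HasDerivAt (fun t : 𝕜 => NormedSpace.exp (t • T) x) (T x) (0 : 𝕜) := by
    have := (hasDerivAt_exp_smul_const' (𝕂 := 𝕜) T (0 : 𝕜)).clm_apply (hasDerivAt_const 0 x)
    simpa using this
  have hd' := (LinearMap.toContinuousLinearMap g).hasFDerivAt.comp_hasDerivAt (0 : 𝕜) hd
  have hzero : (LinearMap.toContinuousLinearMap g) ∘ (fun t : 𝕜 => NormedSpace.exp (t • T) x) =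
      fun _ => 0 :=
    funext fun t => hgN (hmem t)
  rw [hzero] at hd'
  exact hg (hd'.unique (hasDerivAt_const _ _))

/-! ### Vectors of rank one -/

/-- Derivations of a finite extension in characteristic zero vanish. -/
theorem Derivation.eq_zero_of_finiteDimensional {𝕜 K : Type*} [Field 𝕜] [CharZero 𝕜] [Field K]
    [Algebra 𝕜 K] [FiniteDimensional 𝕜 K] (D : Derivation 𝕜 K K) : D = 0 := by
  ext x
  have hx : IsIntegral 𝕜 x := Algebra.IsIntegral.isIntegral x
  have h := D.map_aeval (minpoly 𝕜 x) x
  rw [minpoly.aeval, map_zero, eq_comm, smul_eq_zero] at h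
  exact h.resolve_left
    ((minpoly.irreducible hx).separable.aeval_derivative_ne_zero (minpoly.aeval 𝕜 x))

section RankOne

variable {𝕜 : Type u} {L : Type v} [LieRing L]

/-- The vectors `φ c ∈ V` have rank one over `K`: the map `ad (φ c)` is `y ↦ γ (c l(y))`, where
`l : L → K` vanishes on the derived algebra. -/
structure IsRankOne [Field 𝕜] [LieAlgebra 𝕜 L] {K : Type*} [Field K] [Algebra 𝕜 K]
    (V : Submodule 𝕜 L) (γ φ : K →ₗ[𝕜] L) (l : L →ₗ[𝕜] K) : Prop where
  mem : ∀ c, φ c ∈ V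
  map_lie : ∀ x y : L, l ⁅x, y⁆ = 0
  lie_eq : ∀ (c : K) (y : L), ⁅φ c, y⁆ = γ (c * l y)

section Field

variable [Field 𝕜] [LieAlgebra 𝕜 L] {K : Type w} [Field K] [Algebra 𝕜 K]
    {V : Submodule 𝕜 L} {γ φ : K →ₗ[𝕜] L} {l : L →ₗ[𝕜] K}

theorem IsRankOne.zero : IsRankOne V γ 0 0 where
  mem _ := zero_mem _
  map_lie _ _ := rfl
  lie_eq c y := by simp

theorem IsRankOne.add {φ' : K →ₗ[𝕜] L} {l' : L →ₗ[𝕜] K} (h : IsRankOne V γ φ l)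
    (h' : IsRankOne V γ φ' l') : IsRankOne V γ (φ + φ') (l + l') where
  mem c := add_mem (h.mem c) (h'.mem c)
  map_lie x y := by rw [LinearMap.add_apply, h.map_lie, h'.map_lie, add_zero]
  lie_eq c y := by
    rw [LinearMap.add_apply, LinearMap.add_apply, add_lie, h.lie_eq, h'.lie_eq, mul_add, map_add]

theorem IsRankOne.smul (h : IsRankOne V γ φ l) (a : 𝕜) : IsRankOne V γ (a • φ) (a • l) where
  mem c := Submodule.smul_mem _ a (h.mem c)
  map_lie x y := by rw [LinearMap.smul_apply, h.map_lie, smul_zero]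
  lie_eq c y := by
    rw [LinearMap.smul_apply, LinearMap.smul_apply, smul_lie, h.lie_eq, mul_smul_comm, map_smul]

theorem IsRankOne.comp_mulLeft (h : IsRankOne V γ φ l) (c : K) :
    IsRankOne V γ (φ ∘ₗ LinearMap.mulLeft 𝕜 c) (LinearMap.mulLeft 𝕜 c ∘ₗ l) where
  mem d := h.mem (c * d)
  map_lie x y := by simp [h.map_lie]
  lie_eq d y := by
    simp only [LinearMap.comp_apply, LinearMap.mulLeft_apply, h.lie_eq]
    congr 1
    ring

theorem IsRankOne.map (h : IsRankOne V γ φ l) (e : L ≃ₗ⁅𝕜⁆ L) (he : ∀ x ∈ V, e x ∈ V) :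
    IsRankOne V ((e : L →ₗ[𝕜] L) ∘ₗ γ) ((e : L →ₗ[𝕜] L) ∘ₗ φ) (l ∘ₗ (e.symm : L →ₗ[𝕜] L)) where
  mem c := he _ (h.mem c)
  map_lie x y := by
    change l (e.symm ⁅x, y⁆) = 0
    rw [LieEquiv.map_lie, h.map_lie]
  lie_eq c y := by
    change ⁅e (φ c), y⁆ = e (γ (c * l (e.symm y)))
    rw [← h.lie_eq, LieEquiv.map_lie, LieEquiv.apply_symm_apply]

theorem IsRankOne.derivation (h : IsRankOne V γ φ l) (D : LieDerivation 𝕜 L L)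
    (hD : ∀ x ∈ V, D x ∈ V) {m : K} (hm : ∀ c, D (γ c) = γ (m * c)) :
    IsRankOne V γ ((D : L →ₗ[𝕜] L) ∘ₗ φ)
      (LinearMap.mulLeft 𝕜 m ∘ₗ l - l ∘ₗ (D : L →ₗ[𝕜] L)) where
  mem c := hD _ (h.mem c)
  map_lie x y := by
    change m * l ⁅x, y⁆ - l (D ⁅x, y⁆) = 0
    rw [LieDerivation.apply_lie_eq_add, map_add, h.map_lie, h.map_lie, h.map_lie]
    simp
  lie_eq c y := by
    change ⁅D (φ c), y⁆ = γ (c * (m * l y - l (D y)))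
    have h1 : D ⁅φ c, y⁆ = ⁅φ c, D y⁆ + ⁅D (φ c), y⁆ := LieDerivation.apply_lie_eq_add D _ _
    rw [h.lie_eq, h.lie_eq, hm, ← sub_eq_iff_eq_add', ← map_sub] at h1
    rw [← h1]
    congr 1
    ring

/-- If two families of rank one do not commute, then every derivation acts `K`-linearly on the
image of `γ`. -/
theorem IsRankOne.exists_derivation_eq [CharZero 𝕜] [FiniteDimensional 𝕜 K]
    (h : IsRankOne V γ φ l) (hγ : Function.Injective γ)
    {γ' φ' : K →ₗ[𝕜] L} {l' : L →ₗ[𝕜] K} (h' : IsRankOne V γ' φ' l')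
    (hγ' : Function.Injective γ') (hne : ∃ c c', ⁅φ c, φ' c'⁆ ≠ 0) (D : LieDerivation 𝕜 L L) :
    ∃ m : K, ∀ c, D (γ c) = γ (m * c) := by
  have hskew : ∀ c c', γ (c * l (φ' c')) = -γ' (c' * l' (φ c)) := fun c c' => by
    rw [← h.lie_eq, ← h'.lie_eq, lie_skew]
  obtain ⟨c₀, c₀', hne⟩ := hne
  have hc₀' : l (φ' c₀') ≠ 0 := fun h0 => hne (by rw [h.lie_eq, h0, mul_zero, map_zero])
  have hinj' : Function.Injective (l' ∘ₗ φ) := by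
    rw [injective_iff_map_eq_zero]
    intro c hc
    have h1 := hskew c c₀'
    rw [show l' (φ c) = 0 from hc, mul_zero, map_zero, neg_zero] at h1
    exact (mul_eq_zero.mp (hγ (h1.trans (map_zero γ).symm))).resolve_right hc₀'
  have hinj : Function.Injective (l ∘ₗ φ') := by
    rw [injective_iff_map_eq_zero]
    intro c hc
    have h1 := hskew 1 c
    rw [show l (φ' c) = 0 from hc, mul_zero, map_zero, eq_comm, neg_eq_zero] at h1
    refine (mul_eq_zero.mp (hγ' (h1.trans (map_zero γ').symm))).resolve_right fun h2 => ?_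
    exact one_ne_zero (hinj' (h2.trans (map_zero (l' ∘ₗ φ)).symm))
  let θ := LinearEquiv.ofInjectiveEndo _ hinj
  let θ' := LinearEquiv.ofInjectiveEndo _ hinj'
  let μ : K →ₗ[𝕜] K := θ'.symm ∘ₗ l' ∘ₗ (D : L →ₗ[𝕜] L) ∘ₗ φ
  let κ : K →ₗ[𝕜] K := l ∘ₗ (D : L →ₗ[𝕜] L) ∘ₗ φ' ∘ₗ θ.symm
  -- apply `D` to the bracket of the two families
  have hD : ∀ c d, D (γ (c * d)) = γ (μ c * d + c * κ d) := fun c d => by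
    have e1 : l (φ' (θ.symm d)) = d := θ.apply_symm_apply d
    have e2 : l' (φ (μ c)) = l' (D (φ c)) := θ'.apply_symm_apply _
    have e3 : γ (μ c * d) = -γ' (θ.symm d * l' (D (φ c))) := by
      rw [← e2, ← hskew, e1]
    have e4 : D ⁅φ c, φ' (θ.symm d)⁆ =
        ⁅φ c, D (φ' (θ.symm d))⁆ + ⁅D (φ c), φ' (θ.symm d)⁆ :=
      LieDerivation.apply_lie_eq_add D _ _
    rw [h.lie_eq, h.lie_eq, e1, ← lie_skew (D (φ c)), h'.lie_eq, ← e3] at e4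
    rw [e4, map_add, add_comm]
    rfl
  let δ : K →ₗ[𝕜] K := μ + LinearMap.mulRight 𝕜 (κ 1)
  have hδ : ∀ c, D (γ c) = γ (δ c) := fun c => by
    have := hD c 1
    rw [mul_one, mul_one] at this
    exact this
  have hδmul : ∀ c d, δ (c * d) = μ c * d + c * κ d := fun c d =>
    hγ ((hδ _).symm.trans (hD c d))
  -- the defect of `δ` from multiplication by `δ 1` is a derivation of `K`
  let E : Derivation 𝕜 K K := Derivation.mk' (δ - LinearMap.mulLeft 𝕜 (δ 1)) fun c d => by
    have e1 : δ c = μ c + c * κ 1 := rfl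
    have e2 : δ d = μ 1 * d + κ d := by rw [← one_mul d, hδmul, one_mul, one_mul]
    have e3 : δ 1 = μ 1 + κ 1 := by
      change μ 1 + 1 * κ 1 = _
      rw [one_mul]
    simp only [LinearMap.sub_apply, LinearMap.mulLeft_apply, smul_eq_mul]
    rw [hδmul, e1, e2, e3]
    ring
  refine ⟨δ 1, fun c => ?_⟩
  have hE : E c = 0 := by rw [Derivation.eq_zero_of_finiteDimensional E]; rfl
  rw [hδ]
  congr 1
  exact sub_eq_zero.mp hE

end Field

/-- A subspace of `𝔤₋₁` that is nonzero and invariant under the derivations of degree zero is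
all of `𝔤₋₁`. -/
theorem IsSubFree.le_of_forall_derivation [Field 𝕜] [LieAlgebra 𝕜 L] {𝒢 : ℤ → Submodule 𝕜 L}
    {g₀ : LieSubalgebra 𝕜 (Module.End 𝕜 (𝒢 (-1)))} (hsub : IsSubFree 𝕜 𝒢 g₀) (N : Submodule 𝕜 L)
    (hN : ∀ D : LieDerivation 𝕜 L L, (∀ x ∈ 𝒢 (-1), D x ∈ 𝒢 (-1)) →
      ∀ x ∈ N, D x ∈ N)
    (hne : ∃ x ∈ N, x ∈ 𝒢 (-1) ∧ x ≠ 0) : 𝒢 (-1) ≤ N := by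
  let P : LieSubmodule 𝕜 g₀ (𝒢 (-1)) :=
    { N.comap (𝒢 (-1)).subtype with
      lie_mem := fun {A x} hx => by
        obtain ⟨D, hD, hDA⟩ := hsub.acts A A.2
        have := hN D (hD (-1)) x hx
        rw [hDA x] at this
        exact this }
  have hirr := hsub.irreducible
  rcases eq_bot_or_eq_top P with hP | hP
  · obtain ⟨x, hxN, hx, hx0⟩ := hne
    have : (⟨x, hx⟩ : 𝒢 (-1)) ∈ P := hxN
    rw [hP, LieSubmodule.mem_bot] at this
    exact absurd (congrArg Subtype.val this) hx0
  · intro x hx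
    have : (⟨x, hx⟩ : 𝒢 (-1)) ∈ P := by rw [hP]; trivial
    exact this

theorem IsFundamentalGNLA.lie_eq_zero_of_forall [Field 𝕜] [LieAlgebra 𝕜 L]
    {𝒢 : ℤ → Submodule 𝕜 L} (h : IsFundamentalGNLA 𝕜 𝒢) {x : L}
    (hx : ∀ v ∈ 𝒢 (-1), ⁅x, v⁆ = 0) (y : L) : ⁅x, y⁆ = 0 :=
  h.induction (LinearMap.ker (LieAlgebra.ad 𝕜 L x)) hx
    (fun a (ha : ⁅x, a⁆ = 0) b (hb : ⁅x, b⁆ = 0) => by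
      change ⁅x, ⁅a, b⁆⁆ = 0
      rw [leibniz_lie, ha, hb, zero_lie, lie_zero, add_zero]) y

/-- In a sub-free algebra, one nonzero family of rank one over `K` yields, for suitable `γ`, a
family of rank one through every vector of `𝔤₋₁`. -/
theorem IsSubFree.exists_isRankOne [RCLike 𝕜] [LieAlgebra 𝕜 L] {𝒢 : ℤ → Submodule 𝕜 L}
    {g₀ : LieSubalgebra 𝕜 (Module.End 𝕜 (𝒢 (-1)))} (hsub : IsSubFree 𝕜 𝒢 g₀)
    {K : Type w} [Field K] [Algebra 𝕜 K] [FiniteDimensional 𝕜 K]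
    {γ φ : K →ₗ[𝕜] L} {l : L →ₗ[𝕜] K} (h : IsRankOne (𝒢 (-1)) γ φ l)
    (hγ : Function.Injective γ) (hφ : φ ≠ 0) :
    ∃ γ : K →ₗ[𝕜] L, Function.Injective γ ∧
      ∀ v ∈ 𝒢 (-1), ∃ φ l, IsRankOne (𝒢 (-1)) γ φ l ∧ φ 1 = v := by
  have hf := hsub.fundamental
  have := hf.finiteDimensional
  obtain ⟨c, hc⟩ : ∃ c, φ c ≠ 0 := by
    by_contra hcon
    push Not at hcon
    exact hφ (LinearMap.ext hcon)
  -- the span of all vectors of rank one, a subspace invariant under automorphisms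
  let N : Submodule 𝕜 L := Submodule.span 𝕜 {v | ∃ (γ φ : K →ₗ[𝕜] L) (l : L →ₗ[𝕜] K) (c : K),
    Function.Injective γ ∧ IsRankOne (𝒢 (-1)) γ φ l ∧ φ c = v}
  have hN : 𝒢 (-1) ≤ N := by
    refine hsub.le_of_forall_derivation N (fun D hD x hx =>
      D.apply_mem_of_forall_lieEquiv (𝒢 (-1)) N hD (fun e he => ?_) hx)
      ⟨φ c, Submodule.subset_span ⟨γ, φ, l, c, hγ, h, rfl⟩, h.mem c, hc⟩
    refine Submodule.span_le (p := N.comap (e : L →ₗ[𝕜] L)) |>.mpr ?_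
    rintro _ ⟨γ, φ, l, c, hγ, h, rfl⟩
    exact Submodule.subset_span ⟨_, _, _, c, e.injective.comp hγ, h.map e he, rfl⟩
  -- the vectors of rank one cannot all commute
  obtain ⟨γ₁, φ₁, l₁, c₁, hγ₁, h₁, γ₂, φ₂, l₂, c₂, hγ₂, h₂, hne⟩ :
      ∃ (γ₁ φ₁ : K →ₗ[𝕜] L) (l₁ : L →ₗ[𝕜] K) (c₁ : K) (_ : Function.Injective γ₁)
        (_ : IsRankOne (𝒢 (-1)) γ₁ φ₁ l₁) (γ₂ φ₂ : K →ₗ[𝕜] L) (l₂ : L →ₗ[𝕜] K) (c₂ : K)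
        (_ : Function.Injective γ₂) (_ : IsRankOne (𝒢 (-1)) γ₂ φ₂ l₂), ⁅φ₁ c₁, φ₂ c₂⁆ ≠ 0 := by
    by_contra hcon
    push Not at hcon
    refine hc (hf.central_eq_zero _ (h.mem c) (hf.lie_eq_zero_of_forall fun v hv => ?_))
    refine (Submodule.span_le (p := LinearMap.ker (LieAlgebra.ad 𝕜 L (φ c)))).mpr ?_ (hN hv)
    rintro _ ⟨γ₂, φ₂, l₂, c₂, hγ₂, h₂, rfl⟩
    exact hcon γ φ l c hγ h γ₂ φ₂ l₂ c₂ hγ₂ h₂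
  have hD := fun D => h₁.exists_derivation_eq hγ₁ h₂ hγ₂ ⟨c₁, c₂, hne⟩ D
  refine ⟨γ₁, hγ₁, ?_⟩
  let P : Submodule 𝕜 L :=
    { carrier := {v | ∃ φ l, IsRankOne (𝒢 (-1)) γ₁ φ l ∧ φ 1 = v}
      add_mem' := by
        rintro _ _ ⟨φ, l, h, rfl⟩ ⟨φ', l', h', rfl⟩
        exact ⟨_, _, h.add h', rfl⟩
      zero_mem' := ⟨_, _, .zero, rfl⟩
      smul_mem' := by
        rintro a _ ⟨φ, l, h, rfl⟩
        exact ⟨_, _, h.smul a, rfl⟩ }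
  have hP : 𝒢 (-1) ≤ P := by
    refine hsub.le_of_forall_derivation P (fun D hDV x hx => ?_)
      ⟨φ₁ c₁, ⟨_, _, h₁.comp_mulLeft c₁, by simp⟩, h₁.mem c₁, fun h0 => hne (by simp [h0])⟩
    obtain ⟨φ, l, h, rfl⟩ := hx
    obtain ⟨m, hm⟩ := hD D
    exact ⟨_, _, h.derivation D hDV hm, rfl⟩
  exact fun v hv => hP hv

end RankOne

/-! ### Recognition of Heisenberg algebras -/

theorem isHeisenbergOver_of_exists {F : Type u} [Field F] {L : Type v} [LieRing L]
    [LieAlgebra F L] {z : L} (hz : z ≠ 0) (hbracket : ∃ x y : L, ⁅x, y⁆ = z)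
    (hcentral : ∀ y : L, ⁅z, y⁆ = 0) (hlie : ∀ x y : L, ∃ c : F, ⁅x, y⁆ = c • z)
    (hcenter : ∀ x : L, (∀ y : L, ⁅x, y⁆ = 0) → ∃ c : F, x = c • z) :
    IsHeisenbergOver F L := by
  have hmem : ∀ x : L, x ∈ LieAlgebra.center F L ↔ ∀ y : L, ⁅x, y⁆ = 0 := fun x => by
    rw [LieModule.mem_maxTrivSubmodule]
    exact forall_congr' fun y => by rw [← lie_skew, neg_eq_zero]
  have hzc : z ∈ LieAlgebra.center F L := (hmem z).mpr hcentral
  refine ⟨le_antisymm ?_ ?_, ?_⟩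
  · rw [LieSubmodule.lie_le_iff]
    intro x _ y _
    obtain ⟨c, hc⟩ := hlie x y
    rw [hc]
    exact Submodule.smul_mem _ c hzc
  · intro x hx
    obtain ⟨c, rfl⟩ := hcenter x ((hmem x).mp hx)
    obtain ⟨x, y, rfl⟩ := hbracket
    exact Submodule.smul_mem _ c
      (LieSubmodule.lie_mem_lie (LieSubmodule.mem_top x) (LieSubmodule.mem_top y))
  · refine finrank_eq_one (⟨z, hzc⟩ : LieAlgebra.center F L)
      (fun h => hz (congrArg Subtype.val h)) fun x => ?_
    obtain ⟨c, hc⟩ := hcenter x ((hmem x).mp x.2)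
    exact ⟨c, Subtype.ext hc.symm⟩

section Heisenberg

variable {𝕜 : Type u} {L : Type v} [LieRing L]

/-- The values of `γ` are brackets. -/
theorem IsRankOne.exists_lie_eq [Field 𝕜] [LieAlgebra 𝕜 L]
    {𝒢 : ℤ → Submodule 𝕜 L} {K : Type w} [Field K] [Algebra 𝕜 K]
    {γ φ : K →ₗ[𝕜] L} {l : L →ₗ[𝕜] K} (h : IsRankOne (𝒢 (-1)) γ φ l)
    (hf : IsFundamentalGNLA 𝕜 𝒢) (hφ : φ ≠ 0) (c : K) : ∃ x y : L, ⁅x, y⁆ = γ c := by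
  obtain ⟨e, he⟩ : ∃ e, l e ≠ 0 := by
    by_contra hcon
    push Not at hcon
    exact hφ (LinearMap.ext fun c => hf.central_eq_zero _ (h.mem c) fun y => by
      rw [h.lie_eq, hcon, mul_zero, map_zero])
  exact ⟨φ (c * (l e)⁻¹), e, by rw [h.lie_eq, inv_mul_cancel_right₀ he]⟩

/-- All vectors of `𝔤₋₁` have rank one over `K`, for one and the same injective `γ : K → L`. As
shown below, `L` is then a Heisenberg algebra over `K`, with centre the range of `γ`. -/
structure IsRankOneAlgebra [Field 𝕜] [LieAlgebra 𝕜 L] (𝒢 : ℤ → Submodule 𝕜 L)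
    {K : Type w} [Field K] [Algebra 𝕜 K] (γ : K →ₗ[𝕜] L) : Prop where
  fundamental : IsFundamentalGNLA 𝕜 𝒢
  injective : Function.Injective γ
  exists_isRankOne : ∀ v ∈ 𝒢 (-1), ∃ φ l, IsRankOne (𝒢 (-1)) γ φ l ∧ φ 1 = v
  exists_ne_zero : ∃ v ∈ 𝒢 (-1), v ≠ 0

namespace IsRankOneAlgebra

section Field

variable [Field 𝕜] [LieAlgebra 𝕜 L] {𝒢 : ℤ → Submodule 𝕜 L} {K : Type w} [Field K] [Algebra 𝕜 K]
    {γ : K →ₗ[𝕜] L}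

theorem exists_lie_eq (h : IsRankOneAlgebra 𝒢 γ) (c : K) : ∃ x y : L, ⁅x, y⁆ = γ c := by
  obtain ⟨v, hv, hv0⟩ := h.exists_ne_zero
  obtain ⟨φ, l, hφ, rfl⟩ := h.exists_isRankOne v hv
  exact hφ.exists_lie_eq h.fundamental (fun h0 => hv0 (by rw [h0]; rfl)) c

theorem lie_apply_left (h : IsRankOneAlgebra 𝒢 γ) (c : K) (y : L) : ⁅γ c, y⁆ = 0 := by
  refine h.fundamental.lie_eq_zero_of_forall (fun v hv => ?_) y
  obtain ⟨φ, l, hφ, rfl⟩ := h.exists_isRankOne v hv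
  obtain ⟨x, y, hxy⟩ := h.exists_lie_eq c
  rw [← lie_skew, hφ.lie_eq, ← hxy, hφ.map_lie, mul_zero, map_zero, neg_zero]

theorem exists_add_eq (h : IsRankOneAlgebra 𝒢 γ) (x : L) :
    ∃ φ l c, IsRankOne (𝒢 (-1)) γ φ l ∧ φ 1 + γ c = x := by
  have hx : x ∈ 𝒢 (-1) ⊔ LinearMap.range γ := by
    refine h.fundamental.induction _ le_sup_left (fun x hx y _ => ?_) x
    obtain ⟨v, hv, _, ⟨c, rfl⟩, rfl⟩ := Submodule.mem_sup.mp hx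
    obtain ⟨φ, l, hφ, rfl⟩ := h.exists_isRankOne v hv
    refine Submodule.mem_sup_right ⟨1 * l y, ?_⟩
    rw [add_lie, h.lie_apply_left, add_zero, hφ.lie_eq]
  obtain ⟨v, hv, _, ⟨c, rfl⟩, rfl⟩ := Submodule.mem_sup.mp hx
  obtain ⟨φ, l, hφ, rfl⟩ := h.exists_isRankOne v hv
  exact ⟨φ, l, c, hφ, rfl⟩

theorem exists_lie_eq_apply (h : IsRankOneAlgebra 𝒢 γ) (x y : L) : ∃ c, ⁅x, y⁆ = γ c := by
  obtain ⟨φ, l, c, hφ, rfl⟩ := h.exists_add_eq x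
  exact ⟨1 * l y, by rw [add_lie, h.lie_apply_left, add_zero, hφ.lie_eq]⟩

theorem exists_eq_of_central (h : IsRankOneAlgebra 𝒢 γ) {x : L} (hx : ∀ y : L, ⁅x, y⁆ = 0) :
    ∃ c, x = γ c := by
  obtain ⟨φ, l, c, hφ, rfl⟩ := h.exists_add_eq x
  refine ⟨c, ?_⟩
  rw [h.fundamental.central_eq_zero (φ 1) (hφ.mem 1), zero_add]
  intro y
  rw [← hx y, add_lie, h.lie_apply_left, add_zero]

/-- The action of `K` on `L` by `k (φ c) = φ (k c)` and `k (γ c) = γ (k c)`, for which the bracket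
of `L` is `K`-bilinear. -/
theorem exists_algHom (h : IsRankOneAlgebra 𝒢 γ) : ∃ T : K →ₐ[𝕜] Module.End 𝕜 L,
    (∀ k c, T k (γ c) = γ (k * c)) ∧ ∀ k (x y : L), ⁅T k x, y⁆ = T k ⁅x, y⁆ := by
  let P : Submodule 𝕜 (K →ₗ[𝕜] L) :=
    { carrier := {φ | ∃ l, IsRankOne (𝒢 (-1)) γ φ l}
      add_mem' := fun ⟨l, hl⟩ ⟨l', hl'⟩ => ⟨_, hl.add hl'⟩
      zero_mem' := ⟨0, .zero⟩
      smul_mem' := fun a _ ⟨l, hl⟩ => ⟨_, hl.smul a⟩ }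
  let Ψ : (P × K) →ₗ[𝕜] L :=
    LinearMap.coprod (LinearMap.applyₗ 1 ∘ₗ P.subtype) γ
  have hΨ : ∀ p, Ψ p = (p.1 : K →ₗ[𝕜] L) 1 + γ p.2 := fun p => rfl
  have hbij : Function.Bijective Ψ := by
    constructor
    · rw [injective_iff_map_eq_zero]
      rintro ⟨⟨φ, l, hφ⟩, c⟩ hp
      have hp' : φ 1 + γ c = 0 := hp
      -- `φ 1 = -γ c` is central, so that `l = 0`
      have h1 : ∀ y, l y = 0 := fun y => by
        have h2 : γ (1 * l y) = 0 := by
          rw [← hφ.lie_eq, eq_neg_of_add_eq_zero_left hp', neg_lie, h.lie_apply_left, neg_zero]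
        rw [one_mul] at h2
        exact h.injective (h2.trans (map_zero γ).symm)
      have h3 : φ = 0 := LinearMap.ext fun c =>
        h.fundamental.central_eq_zero _ (hφ.mem c) fun y => by
          rw [hφ.lie_eq, h1, mul_zero, map_zero]
      have h4 : c = 0 := by
        rw [h3, LinearMap.zero_apply, zero_add] at hp'
        exact h.injective (hp'.trans (map_zero γ).symm)
      ext1
      · exact Subtype.ext h3
      · exact h4
    · intro x
      obtain ⟨φ, l, c, hφ, rfl⟩ := h.exists_add_eq x
      exact ⟨(⟨φ, l, hφ⟩, c), rfl⟩
  let e := LinearEquiv.ofBijective Ψ hbij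
  have hP : ∀ k, ∀ φ ∈ P, φ ∘ₗ LinearMap.mulLeft 𝕜 k ∈ P := fun k φ ⟨l, hl⟩ =>
    ⟨_, hl.comp_mulLeft k⟩
  let σ : K → (P × K) →ₗ[𝕜] (P × K) := fun k =>
    ((LinearMap.lcomp 𝕜 L (LinearMap.mulLeft 𝕜 k)).restrict (hP k)).prodMap
      (LinearMap.mulLeft 𝕜 k)
  let T : K → Module.End 𝕜 L := fun k => Ψ ∘ₗ σ k ∘ₗ e.symm
  have hT : ∀ (k : K) (φ : K →ₗ[𝕜] L) (_ : φ ∈ P) (c : K),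
      T k (φ 1 + γ c) = φ k + γ (k * c) := fun k φ hφ c => by
    have h1 : e.symm (φ 1 + γ c) = (⟨φ, hφ⟩, c) := e.symm_apply_apply (⟨φ, hφ⟩, c)
    change Ψ (σ k (e.symm (φ 1 + γ c))) = _
    rw [h1]
    change φ (k * 1) + γ (k * c) = _
    rw [mul_one]
  have hTγ : ∀ k c, T k (γ c) = γ (k * c) := fun k c => by
    simpa using hT k 0 P.zero_mem c
  have hext : ∀ A B : Module.End 𝕜 L, (∀ φ ∈ P, ∀ c, A (φ 1 + γ c) = B (φ 1 + γ c)) → A = B :=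
    fun A B hAB => LinearMap.ext fun x => by
      obtain ⟨φ, l, c, hφ, rfl⟩ := h.exists_add_eq x
      exact hAB φ ⟨l, hφ⟩ c
  have halg : ∀ a : 𝕜, T (algebraMap 𝕜 K a) = algebraMap 𝕜 (Module.End 𝕜 L) a := fun a =>
    hext _ _ fun φ hφ c => by
      rw [hT _ φ hφ, Module.algebraMap_end_apply, Algebra.algebraMap_eq_smul_one, smul_one_mul,
        map_smul, map_smul, smul_add]
  refine ⟨{ toFun := T, map_one' := ?_, map_mul' := ?_, map_zero' := ?_, map_add' := ?_,
            commutes' := halg }, hTγ, ?_⟩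
  · exact hext _ _ fun φ hφ c => by rw [hT _ φ hφ, one_mul, Module.End.one_apply]
  · refine fun k k' => hext _ _ fun φ hφ c => ?_
    have h1 := hT k _ (hP k' φ hφ) (k' * c)
    simp only [LinearMap.comp_apply, LinearMap.mulLeft_apply, mul_one] at h1
    rw [hT _ φ hφ, Module.End.mul_apply, hT _ φ hφ, h1, mul_comm k k', mul_left_comm, mul_assoc]
  · exact hext _ _ fun φ hφ c => by
      rw [hT _ φ hφ, zero_mul, map_zero, map_zero, add_zero, LinearMap.zero_apply]
  · exact fun k k' => hext _ _ fun φ hφ c => by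
      rw [hT _ φ hφ, LinearMap.add_apply, hT _ φ hφ, hT _ φ hφ, add_mul, map_add, map_add]
      abel
  · intro k x y
    change ⁅T k x, y⁆ = T k ⁅x, y⁆
    obtain ⟨φ, l, c, hφ, rfl⟩ := h.exists_add_eq x
    rw [hT k φ ⟨l, hφ⟩, add_lie, add_lie, h.lie_apply_left, h.lie_apply_left, add_zero, add_zero,
      hφ.lie_eq, hφ.lie_eq, hTγ, one_mul]

end Field

theorem isHeisenbergOver [Field 𝕜] [LieAlgebra 𝕜 L] {𝒢 : ℤ → Submodule 𝕜 L} {γ : 𝕜 →ₗ[𝕜] L}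
    (h : IsRankOneAlgebra 𝒢 γ) : IsHeisenbergOver 𝕜 L := by
  have hγ : ∀ c, γ c = c • γ 1 := fun c => by rw [← map_smul, smul_eq_mul, mul_one]
  refine isHeisenbergOver_of_exists (z := γ 1)
    (fun h0 => one_ne_zero (h.injective (h0.trans (map_zero γ).symm)))
    (h.exists_lie_eq 1) (h.lie_apply_left 1) (fun x y => ?_) fun x hx => ?_
  · obtain ⟨c, hc⟩ := h.exists_lie_eq_apply x y
    exact ⟨c, hc.trans (hγ c)⟩
  · obtain ⟨c, hc⟩ := h.exists_eq_of_central hx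
    exact ⟨c, hc.trans (hγ c)⟩

/-- For `K ≅ ℂ`, the algebra `L` is a complex Heisenberg algebra. The complex structure is the
action of `K` on `L`; it extends the real structure, which is all that `hχ` ensures. -/
theorem isHeisenberg [RCLike 𝕜] [LieAlgebra 𝕜 L] {𝒢 : ℤ → Submodule 𝕜 L} {K : Type w} [Field K]
    [Algebra 𝕜 K] {γ : K →ₗ[𝕜] L} (h : IsRankOneAlgebra 𝒢 γ) (χ : ℂ ≃+* K)
    (hχ : ∀ r : ℝ, χ r = algebraMap 𝕜 K r) : IsHeisenberg 𝕜 L := by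
  obtain ⟨T, hTγ, hT⟩ := h.exists_algHom
  let mod : Module ℂ L := Module.compHom L ((T : K →+* Module.End 𝕜 L).comp (χ : ℂ →+* K))
  have hsmul : ∀ (t : ℂ) (x : L), t • x = T (χ t) x := fun t x => rfl
  let lie : LieAlgebra ℂ L :=
    { mod with
      lie_smul := fun t x y => by
        change ⁅x, T (χ t) y⁆ = T (χ t) ⁅x, y⁆
        rw [← lie_skew, hT, ← map_neg, lie_skew] }
  refine Or.inr ⟨lie, fun r x => ?_, ?_⟩
  · change T (χ r) x = _
    rw [hχ, AlgHom.commutes, Module.algebraMap_end_apply]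
  have hγ : ∀ c, γ c = χ.symm c • γ 1 := fun c => by
    rw [hsmul, hTγ, mul_one, RingEquiv.apply_symm_apply]
  refine isHeisenbergOver_of_exists (z := γ 1)
    (fun h0 => one_ne_zero (h.injective (h0.trans (map_zero γ).symm)))
    (h.exists_lie_eq 1) (h.lie_apply_left 1) (fun x y => ?_) fun x hx => ?_
  · obtain ⟨c, hc⟩ := h.exists_lie_eq_apply x y
    exact ⟨χ.symm c, hc.trans (hγ c)⟩
  · obtain ⟨c, hc⟩ := h.exists_eq_of_central hx
    exact ⟨χ.symm c, hc.trans (hγ c)⟩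

end IsRankOneAlgebra

theorem IsSubFree.exists_isRankOneAlgebra [RCLike 𝕜] [LieAlgebra 𝕜 L] {𝒢 : ℤ → Submodule 𝕜 L}
    {g₀ : LieSubalgebra 𝕜 (Module.End 𝕜 (𝒢 (-1)))} (hsub : IsSubFree 𝕜 𝒢 g₀)
    {K : Type w} [Field K] [Algebra 𝕜 K] [FiniteDimensional 𝕜 K]
    {γ φ : K →ₗ[𝕜] L} {l : L →ₗ[𝕜] K} (h : IsRankOne (𝒢 (-1)) γ φ l)
    (hγ : Function.Injective γ) (hφ : φ ≠ 0) :
    ∃ γ : K →ₗ[𝕜] L, IsRankOneAlgebra 𝒢 γ := by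
  obtain ⟨γ', hγ', hv⟩ := hsub.exists_isRankOne h hγ hφ
  refine ⟨γ', hsub.fundamental, hγ', hv, ?_⟩
  by_contra hcon
  push Not at hcon
  exact hφ (LinearMap.ext fun c => hcon _ (h.mem c))

/-- The existence of a vector of rank one over a finite extension of `𝕜` forces a sub-free Lie
algebra to be a Heisenberg algebra. -/
theorem IsSubFree.isHeisenberg [RCLike 𝕜] [LieAlgebra 𝕜 L] {𝒢 : ℤ → Submodule 𝕜 L}
    {g₀ : LieSubalgebra 𝕜 (Module.End 𝕜 (𝒢 (-1)))} (hsub : IsSubFree 𝕜 𝒢 g₀)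
    {K : Type w} [Field K] [Algebra 𝕜 K] [FiniteDimensional 𝕜 K]
    {γ φ : K →ₗ[𝕜] L} {l : L →ₗ[𝕜] K} (h : IsRankOne (𝒢 (-1)) γ φ l) (hφ : φ ≠ 0) :
    IsHeisenberg 𝕜 L := by
  obtain ⟨c₀, hc₀⟩ : ∃ c, φ c ≠ 0 := by
    by_contra hcon
    push Not at hcon
    exact hφ (LinearMap.ext hcon)
  have hγ0 : LinearMap.range γ ≠ ⊥ := fun h0 => hc₀ <|
    hsub.fundamental.central_eq_zero _ (h.mem c₀) fun y => by
      rw [h.lie_eq, LinearMap.range_eq_bot.mp h0, LinearMap.zero_apply]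
  have hpos : 0 < Module.finrank 𝕜 (LinearMap.range γ) :=
    Nat.pos_of_ne_zero fun h0 => hγ0 (Submodule.finrank_eq_zero.mp h0)
  by_cases h1 : Module.finrank 𝕜 (LinearMap.range γ) = 1
  · -- the vector `φ c₀` has rank one over `𝕜`
    let g : LinearMap.range γ ≃ₗ[𝕜] 𝕜 :=
      LinearEquiv.ofFinrankEq _ _ (h1.trans (Module.finrank_self 𝕜).symm)
    let z : L := g.symm 1
    have hz : z ≠ 0 := fun h0 => one_ne_zero (α := 𝕜) <| by
      rw [← g.apply_symm_apply 1, show g.symm 1 = 0 from Subtype.ext h0, map_zero]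
    have hg : ∀ c, γ c = g (γ.rangeRestrict c) • z := fun c => by
      change _ = ((g (γ.rangeRestrict c) • g.symm 1 : LinearMap.range γ) : L)
      rw [← map_smul, smul_eq_mul, mul_one, g.symm_apply_apply]
      rfl
    have h' : IsRankOne (𝒢 (-1)) (LinearMap.toSpanSingleton 𝕜 L z)
        (LinearMap.toSpanSingleton 𝕜 L (φ c₀))
        ((g : LinearMap.range γ →ₗ[𝕜] 𝕜) ∘ₗ γ.rangeRestrict ∘ₗ LinearMap.mulLeft 𝕜 c₀ ∘ₗ l) :=
      { mem := fun c => Submodule.smul_mem _ c (h.mem c₀)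
        map_lie := fun x y => by
          change g (γ.rangeRestrict (c₀ * l ⁅x, y⁆)) = 0
          rw [h.map_lie, mul_zero, map_zero, map_zero]
        lie_eq := fun c y => by
          change ⁅c • φ c₀, y⁆ = (c * g (γ.rangeRestrict (c₀ * l y))) • z
          rw [smul_lie, h.lie_eq, mul_smul, ← hg] }
    obtain ⟨γ', hγ'⟩ := hsub.exists_isRankOneAlgebra h'
      (injective_iff_map_eq_zero _ |>.mpr fun c hc =>
        (smul_eq_zero.mp (show c • z = 0 from hc)).resolve_right hz)
      fun h0 => hc₀ (by simpa using LinearMap.congr_fun h0 1)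
    exact Or.inl hγ'.isHeisenbergOver
  · -- `K` has degree at least two over `𝕜`, which leaves only `K ≅ ℂ`, with `γ` injective
    let _ : Algebra ℝ K := ((algebraMap 𝕜 K).comp (algebraMap ℝ 𝕜)).toAlgebra
    have : IsScalarTower ℝ 𝕜 K := IsScalarTower.of_algebraMap_eq fun _ => rfl
    have : FiniteDimensional ℝ K := FiniteDimensional.trans ℝ 𝕜 K
    have hK : Module.finrank 𝕜 K ≤ Module.finrank ℝ K := by
      rw [← Module.finrank_mul_finrank ℝ 𝕜 K]
      exact Nat.le_mul_of_pos_left _ Module.finrank_pos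
    have hγK : Module.finrank 𝕜 (LinearMap.range γ) ≤ Module.finrank 𝕜 K :=
      LinearMap.finrank_range_le γ
    rcases IsAlgClosed.nonempty_algEquiv_or_of_finrank_eq_two K Complex.finrank_real_complex with
      ⟨⟨χ⟩⟩ | ⟨⟨χ⟩⟩
    · have := χ.toLinearEquiv.finrank_eq
      rw [Module.finrank_self] at this
      omega
    · have h2 := χ.toLinearEquiv.finrank_eq
      rw [Complex.finrank_real_complex] at h2
      have hker := γ.finrank_range_add_finrank_ker
      have hγ : Function.Injective γ := by
        rw [← LinearMap.ker_eq_bot, ← Submodule.finrank_eq_zero (R := 𝕜)]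
        omega
      obtain ⟨γ', hγ'⟩ := hsub.exists_isRankOneAlgebra h hγ hφ
      exact hγ'.isHeisenberg χ.symm.toRingEquiv fun r => χ.symm.commutes r

end Heisenberg

/-- If the prolongation is infinite-dimensional, then `L` contains a vector of rank one, over some
finite extension of the base field. -/
theorem IsFundamentalGNLA.finiteDimensional_or_exists_isRankOne {𝕜 : Type u} [Field 𝕜] [CharZero 𝕜]
    {L : Type v} [LieRing L] [LieAlgebra 𝕜 L] {𝒢 : ℤ → Submodule 𝕜 L}
    {g₀ : LieSubalgebra 𝕜 (Module.End 𝕜 (𝒢 (-1)))} (hf : IsFundamentalGNLA 𝕜 𝒢) :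
    FiniteDimensional 𝕜 (Tanaka.Prolongation 𝒢 g₀) ∨
    ∃ (K : Type (max u v)) (_ : Field K) (_ : Algebra 𝕜 K) (_ : FiniteDimensional 𝕜 K)
      (γ φ : K →ₗ[𝕜] L) (l : L →ₗ[𝕜] K), IsRankOne (𝒢 (-1)) γ φ l ∧ φ ≠ 0 := by
  refine (Tanaka.finiteDimensional_or_exists_rankOne hf).imp_right ?_
  rintro ⟨K, _, _, hK, φ, l, hφ, hφ0, hl0, hl, hrec⟩
  obtain ⟨e, he⟩ : ∃ e, l e ≠ 0 := by
    by_contra hcon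
    push Not at hcon
    exact hl0 (LinearMap.ext hcon)
  refine ⟨K, _, _, hK,
    -- `γ c = [φ (c / l(e)), e]`
    -(LieAlgebra.ad 𝕜 L e : L →ₗ[𝕜] L) ∘ₗ φ ∘ₗ LinearMap.mulRight 𝕜 (l e)⁻¹, φ, l,
    ⟨hφ, hl, fun c y => ?_⟩, hφ0⟩
  change _ = -⁅e, φ (c * l y * (l e)⁻¹)⁆
  rw [lie_skew, mul_right_comm, ← hrec, inv_mul_cancel_right₀ he]

end

theorem lemma2 {𝕜 : Type u} [RCLike 𝕜] {L : Type v} [LieRing L] [LieAlgebra 𝕜 L]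
    (𝒢 : ℤ → Submodule 𝕜 L) (g₀ : LieSubalgebra 𝕜 (Module.End 𝕜 (𝒢 (-1))))
    (hsub : IsSubFree 𝕜 𝒢 g₀) (hheis : ¬ IsHeisenberg 𝕜 L) :
    FiniteDimensional 𝕜 (Tanaka.Prolongation 𝒢 g₀) := by
  rcases hsub.fundamental.finiteDimensional_or_exists_isRankOne (g₀ := g₀) with
    hfin | ⟨K, _, _, _, γ, φ, l, h, hφ⟩
  · exact hfin
  · exact absurd (hsub.isHeisenberg h hφ) hheis
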